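/- Let $\mathcal W$ be the space of bounded symmetric measurable functions $f:[0,1]^2\to\mathbb R$. For a finite simple graph $H=(V,E)$ put $t_H(f)=\int_{[0,1]^V}\prod_{kl\in E}f(x_k,x_l)\prod_{k\in V}dx_k$; $H$ is called seminorming if $f\mapsto|t_H(f)|^{1/|E|}$ is a seminorm on $\mathcal W$ (in particular $E\neq\emptyset$). For a symmetric $N\times N$ matrix $X$ let $\hom_H(X)=\sum_{\varphi:V\to[N]}\prod_{vw\in E}X_{\varphi(v)\varphi(w)}$, and for a graph $G$ on $[N]$ let $\hom_H(G)=\hom_H(A_G)$ with $A_G$ the adjacency matrix of $G$. For $p\in(0,1)$ and $x\in[0,1]$ let $I_p(x)=x\log\frac xp+(1-x)\log\frac{1-x}{1-p}$ (with $0\log 0=0$), let $\mathcal X_N$ be the set of symmetric $N\times N$ matrices with entries in $[0,1]$ and zero diagonal, put $I_p(X)=\sum_{i<j}I_p(X_{ij})$ for $X\in\mathcal X_N$, and $$\psi(H,N,p,t)=\inf\{I_p(X):X\in\mathcal X_N,\ \hom_H(X)\le tN^{|V|}p^{|E|}\}.$$ Let $\Delta_\star$ be the maximum over $e\in E$ of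 the number of edges of $H$ that share at least one vertex with $e$ (including $e$ itself). Let $\mathbf G_{N,p}$ denote the Erdős–Rényi random graph $G(N,p)$ on $[N]$. Theorem. Let $H=(V,E)$ be a seminorming graph with $n$ vertices and $m$ edges. (1) For all $0<q<p<1$ and all integers $N\ge1$, with $\widehat q:=q-q/N$, $$\mathbb P\big(\hom_H(\mathbf G_{N,p})\le\widehat q^{\,m}N^n\big)\le e^{-\psi(H,N,p,(\widehat q/p)^m)}\le e^{-\binom N2I_p(q)}.$$ (2) Let $s\in(0,1)$ be fixed, let $p=p(N)$ satisfy $N^{-1/(2\Delta_\star-1)}/p(N)\to0$ as $N\to\infty$ and $0<p(N)\le1/2$ for all large $N$, and put $q=q(N):=s\,p(N)$ and $\widehat q:=q-q/N$. Then, as $N\to\infty$, $$\mathbb P\big(\hom_H(\mathbf G_{N,p})\le\widehat q^{\,m}N^n\big)\ge e^{-(1+o(1))\binom N2I_p(q)}.$$ -/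

import Mathlib

open MeasureTheory Filter Topology Asymptotics
open scoped unitInterval

noncomputable section

namespace LowerTail

/-- `∏_{kl ∈ E(H)} K(x_k, x_l)` for a symmetric kernel `K`. -/
def edgeProd {V : Type*} (H : SimpleGraph V) [Fintype H.edgeSet] {α : Type*}
    (K : α → α → ℝ) (hK : ∀ a b, K a b = K b a) (x : V → α) : ℝ :=
  ∏ e ∈ H.edgeFinset, Sym2.lift ⟨K, hK⟩ (e.map x)

/-- The space of bounded symmetric measurable functions `[0,1]² → ℝ`. -/
def kernelSpace : Submodule ℝ (I → I → ℝ) where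
  carrier := {f | Measurable (Function.uncurry f) ∧ (∀ x y, f x y = f y x) ∧
    ∃ C : ℝ, ∀ x y, |f x y| ≤ C}
  zero_mem' := ⟨measurable_const, fun _ _ => rfl, 0, fun _ _ => by simp⟩
  add_mem' := by
    rintro f g ⟨hf, hf', C, hC⟩ ⟨hg, hg', D, hD⟩
    refine ⟨hf.add hg, fun x y => ?_, C + D, fun x y => ?_⟩
    · simp only [Pi.add_apply, hf' x y, hg' x y]
    · exact (abs_add_le _ _).trans (add_le_add (hC x y) (hD x y))
  smul_mem' := by
    rintro c f ⟨hf, hf', C, hC⟩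
    refine ⟨hf.const_smul c, fun x y => ?_, |c| * C, fun x y => ?_⟩
    · simp only [Pi.smul_apply, hf' x y]
    · simp only [Pi.smul_apply, smul_eq_mul, abs_mul]
      exact mul_le_mul_of_nonneg_left (hC x y) (abs_nonneg c)

/-- The homomorphism density `t_H(f)`, an integral over `[0,1]^V` (Lebesgue measure). -/
def homDensity {V : Type*} [Fintype V] (H : SimpleGraph V) [Fintype H.edgeSet]
    (f : kernelSpace) : ℝ :=
  ∫ x : V → I, edgeProd H f.1 f.2.2.1 x

/-- `H` is seminorming if `f ↦ |t_H(f)|^{1/|E|}` is a seminorm on the space of bounded symmetric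
measurable functions. (An edgeless graph is not: the expression evaluates to `1` at `f = 0`.) -/
def IsSeminorming {V : Type*} [Fintype V] (H : SimpleGraph V) [Fintype H.edgeSet] : Prop :=
  ∃ ρ : Seminorm ℝ kernelSpace,
    ∀ f : kernelSpace, ρ f = |homDensity H f| ^ (1 / (H.edgeFinset.card : ℝ))

/-- `hom_H(X)` for a symmetric `N × N` matrix `X`. -/
def homMatrix {V : Type*} [Fintype V] [DecidableEq V] (H : SimpleGraph V) [Fintype H.edgeSet]
    {N : ℕ} (X : Matrix (Fin N) (Fin N) ℝ) (hX : X.IsSymm) : ℝ :=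
  ∑ φ : V → Fin N, edgeProd H X (fun i j => hX.apply j i) φ

open Classical in
/-- `hom_H(G)` for a graph `G` on `N` vertices, through the adjacency matrix of `G`. -/
def homGraph {V : Type*} [Fintype V] [DecidableEq V] (H : SimpleGraph V) [Fintype H.edgeSet]
    {N : ℕ} (G : SimpleGraph (Fin N)) : ℝ :=
  homMatrix H (G.adjMatrix ℝ) (G.isSymm_adjMatrix)

/-- The symmetric `N × N` matrices with entries in `[0,1]` and zero diagonal. -/
def weightMatrices (N : ℕ) : Set (Matrix (Fin N) (Fin N) ℝ) :=
  {X | X.IsSymm ∧ (∀ i, X i i = 0) ∧ ∀ i j, X i j ∈ Set.Icc (0 : ℝ) 1}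

/-- `I_p(x)`, the relative entropy of Bernoulli(`x`) with respect to Bernoulli(`p`). -/
def relEntropy (p x : ℝ) : ℝ :=
  x * Real.log (x / p) + (1 - x) * Real.log ((1 - x) / (1 - p))

/-- `I_p(X) = ∑_{i<j} I_p(x_{ij})`. -/
def relEntropyMatrix (p : ℝ) {N : ℕ} (X : Matrix (Fin N) (Fin N) ℝ) : ℝ :=
  ∑ i : Fin N, ∑ j ∈ Finset.Ioi i, relEntropy p (X i j)

/-- `ψ(H,N,p,t) = inf { I_p(X) : X ∈ 𝒳_N, hom_H(X) ≤ t N^{|V|} p^{|E|} }`. -/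
def psi {V : Type*} [Fintype V] [DecidableEq V] (H : SimpleGraph V) [Fintype H.edgeSet]
    (N : ℕ) (p t : ℝ) : ℝ :=
  sInf ((fun X : weightMatrices N => relEntropyMatrix p X.1) ''
    {X | homMatrix H X.1 X.2.1 ≤
      t * (N : ℝ) ^ Fintype.card V * p ^ H.edgeFinset.card})

open Classical in
/-- `Δ_⋆(H)`: the largest number of edges meeting a given edge `e` (including `e` itself). -/
def maxEdgeAdj {V : Type*} (H : SimpleGraph V) [Fintype H.edgeSet] : ℕ :=
  H.edgeFinset.sup fun e => (H.edgeFinset.filter fun e' => ∃ v, v ∈ e ∧ v ∈ e').card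

end LowerTail

end

/-! A symmetric matrix is a step kernel on `[0,1]²`, so the seminorm property makes `{X : |hom_H X|
≤ T}` convex. Three arguments build on this.

Convexity bounds probabilities. Condition `G(N,p)` on a lower tail event and let `X` be the
conditional mean of the adjacency matrix; `X` stays in the convex set. Tilting `G(N,p)` to the
product measure with edge probabilities `X` and applying Jensen to `exp` gives `P(A) ≤ exp
(-I_p(X))` (`exists_weightMatrix_prob_le`), hence the bound by `exp (-ψ)`.

Convexity also gives Sidorenko's inequality (`IsSeminorming.sidorenko`): averaging all relabelings
of a blow-up of `X` does not increase `hom_H` and makes the off-diagonal entries constant. A matrix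
feasible for `ψ` therefore has mean entry at most `q - q/N`, that is, mean off-diagonal entry at
most `q`, and the tangent line of the convex function `I_p` at `q` bounds its entropy from below.

For part (2), compare with `G(N,q')`, where `q' = (1-ε)sp`. There the expectation of `hom_H` is at
most `(1+o(1)) q'^m N^n`, because a map that identifies vertices loses at most `Δ_⋆` edges per lost
vertex and `N p^{Δ_⋆} → ∞`. Markov's inequality gives the event probability at least `ε/2` under
`G(N,q')`. Since `G(N,q')` rarely has too few edges, returning to `G(N,p)` costs a factor `exp
(-(1+O(ε)) (N choose 2) I_p(sp))` (`tilted_lower_bound`, `tilted_exponent_le`). Finally `ε` is taken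
small. -/

noncomputable section

namespace LowerTail

/-! ### Matrices as step kernels -/

section StepKernels

/-- The index of the interval `[i/N, (i+1)/N)` containing a point of `[0,1]`. -/
def blockIndex (N : ℕ) [NeZero N] (x : I) : Fin N :=
  ⟨min ⌊(N : ℝ) * x⌋₊ (N - 1), by have := NeZero.pos N; omega⟩

lemma measurable_blockIndex (N : ℕ) [NeZero N] : Measurable (blockIndex N) := by
  have h : Measurable fun x : I => min ⌊(N : ℝ) * x⌋₊ (N - 1) :=
    (Nat.measurable_floor.comp (measurable_const.mul measurable_subtype_coe)).min measurable_const
  refine measurable_to_countable' fun i => ?_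
  have : blockIndex N ⁻¹' {i} = (fun x : I => min ⌊(N : ℝ) * x⌋₊ (N - 1)) ⁻¹' {(i : ℕ)} := by
    ext x
    simp [blockIndex, Fin.ext_iff]
  rw [this]
  exact h (measurableSet_singleton _)

lemma volume_blockIndex_preimage (N : ℕ) [NeZero N] (i : Fin N) :
    volume (blockIndex N ⁻¹' {i}) = ENNReal.ofReal (1 / N) := by
  have hN : (0 : ℝ) < N := by exact_mod_cast NeZero.pos N
  have hi : ((i : ℕ) : ℝ) + 1 ≤ N := by exact_mod_cast i.2
  have ha : ((i : ℕ) : ℝ) / N ∈ I := ⟨by positivity, by rw [div_le_one hN]; linarith⟩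
  have hb : (((i : ℕ) : ℝ) + 1) / N ∈ I := ⟨by positivity, by rwa [div_le_one hN]⟩
  -- The truncation at `N - 1` puts the point `1` into the last block, which is thus a closed
  -- interval; the others are half-open.
  by_cases hlast : (i : ℕ) = N - 1
  · have : blockIndex N ⁻¹' {i} = Set.Ici ⟨_, ha⟩ := by
      ext x
      simp only [Set.mem_preimage, Set.mem_singleton_iff, blockIndex, Fin.ext_iff, Set.mem_Ici,
        ← Subtype.coe_le_coe]
      rw [div_le_iff₀ hN, mul_comm (x : ℝ), ← Nat.le_floor_iff (mul_nonneg hN.le x.2.1)]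
      omega
    rw [this, unitInterval.volume_Ici]
    have h : ((i : ℕ) : ℝ) + 1 = N := by
      exact_mod_cast (show (i : ℕ) + 1 = N by have := NeZero.pos N; omega)
    congr 1
    simp only
    rw [← h]
    field_simp
    ring
  · have : blockIndex N ⁻¹' {i} = Set.Ico ⟨_, ha⟩ ⟨_, hb⟩ := by
      ext x
      simp only [Set.mem_preimage, Set.mem_singleton_iff, blockIndex, Fin.ext_iff, Set.mem_Ico,
        ← Subtype.coe_le_coe, ← Subtype.coe_lt_coe]
      rw [div_le_iff₀ hN, lt_div_iff₀ hN, mul_comm (x : ℝ),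
        ← Nat.le_floor_iff (mul_nonneg hN.le x.2.1)]
      have h := Nat.floor_lt (mul_nonneg hN.le x.2.1) (n := (i : ℕ) + 1)
      push_cast at h
      rw [← h]
      have := i.2
      omega
    rw [this, unitInterval.volume_Ico]
    congr 1
    field_simp
    ring

/-- The step function on `[0,1]²` with the entries of a symmetric matrix as values. -/
def stepKernel {N : ℕ} [NeZero N] (X : Matrix (Fin N) (Fin N) ℝ) (hX : X.IsSymm) : kernelSpace :=
  ⟨fun x y => X (blockIndex N x) (blockIndex N y), by
    refine ⟨?_, fun x y => hX.apply _ _, ∑ i, ∑ j, |X i j|, fun x y => ?_⟩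
    · exact (measurable_of_finite fun z : Fin N × Fin N => X z.1 z.2).comp
        (((measurable_blockIndex N).comp measurable_fst).prodMk
          ((measurable_blockIndex N).comp measurable_snd))
    · exact (Finset.single_le_sum (f := fun j => |X (blockIndex N x) j|)
        (fun _ _ => abs_nonneg _) (Finset.mem_univ (blockIndex N y))).trans
        (Finset.single_le_sum (f := fun i => ∑ j, |X i j|)
          (fun _ _ => Finset.sum_nonneg fun _ _ => abs_nonneg _)
          (Finset.mem_univ (blockIndex N x)))⟩

lemma edgeProd_comp {V α β : Type*} (H : SimpleGraph V) [Fintype H.edgeSet]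
    (K : β → β → ℝ) (hK : ∀ a b, K a b = K b a)
    (g : α → β) (hK' : ∀ a b, K (g a) (g b) = K (g b) (g a)) (x : V → α) :
    edgeProd H (fun a b => K (g a) (g b)) hK' x = edgeProd H K hK (g ∘ x) := by
  refine Finset.prod_congr rfl fun e _ => ?_
  induction e with | _ a b => rfl

variable {V : Type*} [Fintype V] [DecidableEq V] (H : SimpleGraph V) [Fintype H.edgeSet]

/-- The block indices of independent uniform points are independent and uniform on `[N]`, so the
integral is an average over all maps `V → [N]`. -/
lemma homDensity_stepKernel {N : ℕ} [NeZero N] (X : Matrix (Fin N) (Fin N) ℝ) (hX : X.IsSymm) :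
    homDensity H (stepKernel X hX) = homMatrix H X hX / (N : ℝ) ^ Fintype.card V := by
  have hmap : MeasurePreserving (blockIndex N) volume (volume.map (blockIndex N)) :=
    (measurable_blockIndex N).measurePreserving _
  have : IsProbabilityMeasure ((volume : Measure I).map (blockIndex N)) :=
    Measure.isProbabilityMeasure_map (measurable_blockIndex N).aemeasurable
  have hpi := measurePreserving_pi (fun _ : V => (volume : Measure I))
    (fun _ => volume.map (blockIndex N)) (f := fun _ => blockIndex N) fun _ => hmap
  have h1 : homDensity H (stepKernel X hX) =
      ∫ φ : V → Fin N, edgeProd H X (fun i j => hX.apply j i) φ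
        ∂(Measure.pi fun _ : V => (volume : Measure I).map (blockIndex N)) := by
    rw [← hpi.map_eq, integral_map hpi.measurable.aemeasurable
      (measurable_of_finite _).aestronglyMeasurable]
    exact integral_congr_ae <| .of_forall fun x =>
      edgeProd_comp H X (fun i j => hX.apply j i) (blockIndex N) _ x
  rw [h1, integral_fintype .of_finite, homMatrix, Finset.sum_div]
  refine Finset.sum_congr rfl fun φ _ => ?_
  have h2 : (Measure.pi fun _ : V => (volume : Measure I).map (blockIndex N)).real {φ} =
      (1 / N) ^ Fintype.card V := by
    rw [measureReal_def, Measure.pi_singleton]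
    simp_rw [Measure.map_apply (measurable_blockIndex N) (measurableSet_singleton _),
      volume_blockIndex_preimage]
    rw [Finset.prod_const, Finset.card_univ, ENNReal.toReal_pow,
      ENNReal.toReal_ofReal (by positivity)]
  rw [h2, smul_eq_mul, one_div, inv_pow, div_eq_inv_mul]

end StepKernels

/-! ### Convexity of the sublevel sets of `hom_H` -/

section Seminorming

lemma IsSeminorming.card_pos {V : Type*} [Fintype V] {H : SimpleGraph V} [Fintype H.edgeSet]
    (hH : IsSeminorming H) : 0 < H.edgeFinset.card := by
  obtain ⟨ρ, hρ⟩ := hH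
  by_contra! h
  have h0 := hρ 0
  simp [Nat.le_zero.1 h] at h0

variable {V : Type*} [Fintype V] [DecidableEq V] {H : SimpleGraph V} [Fintype H.edgeSet]

variable (H) in
/-- The symmetric matrices `X` with `|hom_H(X)| ≤ T`. -/
def homSublevel (N : ℕ) (T : ℝ) : Set (Matrix (Fin N) (Fin N) ℝ) :=
  {X | ∃ hX : X.IsSymm, |homMatrix H X hX| ≤ T}

/-- For `T ≥ 0` the set is the preimage of a seminorm ball under the linear map `X ↦ stepKernel X`.
-/
lemma IsSeminorming.convex_homSublevel (hH : IsSeminorming H) (N : ℕ) [NeZero N] (T : ℝ) :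
    Convex ℝ (homSublevel H N T) := by
  have hm : (0 : ℝ) < 1 / H.edgeFinset.card := by
    have := hH.card_pos
    positivity
  obtain ⟨ρ, hρ⟩ := hH
  have hN : (0 : ℝ) < (N : ℝ) ^ Fintype.card V :=
    pow_pos (by exact_mod_cast NeZero.pos N) _
  by_cases hT : T < 0
  · have : homSublevel H N T = ∅ := by
      ext X
      simp only [homSublevel, Set.mem_ofPred_eq, Set.mem_empty_iff_false, iff_false]
      rintro ⟨_, h⟩
      exact absurd (abs_nonneg _) (not_le.2 (h.trans_lt hT))
    rw [this]
    exact convex_empty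
  push Not at hT
  have key (X : Matrix (Fin N) (Fin N) ℝ) (hX : X.IsSymm) : |homMatrix H X hX| ≤ T ↔
      ρ (stepKernel X hX) ≤ (T / (N : ℝ) ^ Fintype.card V) ^ (1 / (H.edgeFinset.card : ℝ)) := by
    rw [hρ, homDensity_stepKernel, abs_div, abs_of_pos hN,
      Real.rpow_le_rpow_iff (by positivity) (by positivity) hm, div_le_div_iff_of_pos_right hN]
  rintro X ⟨hX, hXT⟩ Y ⟨hY, hYT⟩ a b ha hb hab
  refine ⟨(hX.smul a).add (hY.smul b), ?_⟩
  rw [key] at hXT hYT ⊢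
  have : stepKernel (a • X + b • Y) ((hX.smul a).add (hY.smul b)) =
      a • stepKernel X hX + b • stepKernel Y hY := rfl
  rw [this]
  refine (map_add_le_add ρ _ _).trans ?_
  rw [map_smul_eq_mul, map_smul_eq_mul, Real.norm_of_nonneg ha, Real.norm_of_nonneg hb]
  calc _ ≤ _ := add_le_add (mul_le_mul_of_nonneg_left hXT ha) (mul_le_mul_of_nonneg_left hYT hb)
    _ = _ := by rw [← add_mul, hab, one_mul]

end Seminorming

/-! ### Sidorenko's inequality by averaging blow-ups -/

section Sidorenko

variable {V : Type*} [Fintype V] [DecidableEq V] (H : SimpleGraph V) [Fintype H.edgeSet]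

lemma edgeProd_nonneg {V α : Type*} (H : SimpleGraph V) [Fintype H.edgeSet] {K : α → α → ℝ}
    (hK : ∀ a b, K a b = K b a) (h0 : ∀ a b, 0 ≤ K a b) (x : V → α) : 0 ≤ edgeProd H K hK x := by
  refine Finset.prod_nonneg fun e _ => ?_
  induction e with | _ a b => exact h0 _ _

lemma homMatrix_nonneg {N : ℕ} {X : Matrix (Fin N) (Fin N) ℝ} (hX : X.IsSymm)
    (h0 : ∀ i j, 0 ≤ X i j) : 0 ≤ homMatrix H X hX :=
  Finset.sum_nonneg fun φ _ => edgeProd_nonneg H _ h0 φ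

/-- The projection `[NK] → [N]` all of whose fibres have `K` elements. -/
def blowMap (N K : ℕ) (a : Fin (N * K)) : Fin N := (finProdFinEquiv.symm a).1

lemma sum_comp_blowMap {N K : ℕ} (F : (V → Fin N) → ℝ) :
    ∑ φ : V → Fin (N * K), F (blowMap N K ∘ φ) = (K : ℝ) ^ Fintype.card V * ∑ ψ, F ψ := by
  have h := Fintype.sum_equiv ((Equiv.arrowCongr (Equiv.refl V) finProdFinEquiv.symm).trans
    (Equiv.arrowProdEquivProdArrow V (fun _ => Fin N) fun _ => Fin K))
    (fun φ : V → Fin (N * K) => F (blowMap N K ∘ φ)) (fun z => F z.1) fun φ => rfl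
  rw [h, Fintype.sum_prod_type, Finset.mul_sum]
  refine Finset.sum_congr rfl fun ψ _ => ?_
  simp

lemma homMatrix_blow {N K : ℕ} {X : Matrix (Fin N) (Fin N) ℝ} (hX : X.IsSymm)
    (θ : Equiv.Perm (Fin (N * K))) :
    homMatrix H (X.submatrix (blowMap N K ∘ θ) (blowMap N K ∘ θ)) (hX.submatrix _) =
      (K : ℝ) ^ Fintype.card V * homMatrix H X hX := by
  unfold homMatrix
  rw [← sum_comp_blowMap]
  refine Fintype.sum_equiv (Equiv.arrowCongr (Equiv.refl V) θ) _ _ fun φ => ?_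
  exact edgeProd_comp H X (fun i j => hX.apply j i) (blowMap N K ∘ θ) _ φ

lemma exists_perm_apply_eq_apply_eq {α : Type*} [DecidableEq α] {a b c d : α} (hab : a ≠ b)
    (hcd : c ≠ d) : ∃ π : Equiv.Perm α, π a = c ∧ π b = d := by
  refine ⟨Equiv.swap (Equiv.swap a c b) d * Equiv.swap a c, ?_, ?_⟩
  · rw [Equiv.Perm.mul_apply, Equiv.swap_apply_left, Equiv.swap_apply_of_ne_of_ne _ hcd]
    intro h
    exact hab ((Equiv.swap a c).injective (by rw [Equiv.swap_apply_left]; exact h))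
  · rw [Equiv.Perm.mul_apply, Equiv.swap_apply_left]

/-- The average of all relabelings of the `K`-fold blow-up of `X`. -/
def blowAverage {N : ℕ} (K : ℕ) (X : Matrix (Fin N) (Fin N) ℝ) :
    Matrix (Fin (N * K)) (Fin (N * K)) ℝ :=
  ∑ θ : Equiv.Perm (Fin (N * K)), (((N * K).factorial : ℝ)⁻¹) •
    X.submatrix (blowMap N K ∘ θ) (blowMap N K ∘ θ)

lemma blowAverage_apply {N : ℕ} (K : ℕ) (X : Matrix (Fin N) (Fin N) ℝ) (a b : Fin (N * K)) :
    blowAverage K X a b = ((N * K).factorial : ℝ)⁻¹ *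
      ∑ θ : Equiv.Perm (Fin (N * K)), X (blowMap N K (θ a)) (blowMap N K (θ b)) := by
  simp [blowAverage, Matrix.sum_apply, Finset.mul_sum]

lemma blowAverage_perm {N : ℕ} (K : ℕ) (X : Matrix (Fin N) (Fin N) ℝ)
    (π : Equiv.Perm (Fin (N * K))) (a b : Fin (N * K)) :
    blowAverage K X (π a) (π b) = blowAverage K X a b := by
  rw [blowAverage_apply, blowAverage_apply]
  congr 1
  exact Fintype.sum_equiv (Equiv.mulRight π) _ _ fun θ => rfl

lemma sum_blowAverage {N : ℕ} (K : ℕ) (X : Matrix (Fin N) (Fin N) ℝ) :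
    ∑ a, ∑ b, blowAverage K X a b = (K : ℝ) ^ 2 * ∑ i, ∑ j, X i j := by
  have hone (f : Fin N → ℝ) : ∑ a, f (blowMap N K a) = K * ∑ i, f i := by
    rw [Fintype.sum_equiv finProdFinEquiv.symm (fun a => f (blowMap N K a)) (fun z => f z.1)
      fun a => rfl, Fintype.sum_prod_type, Finset.mul_sum]
    simp
  have hθ (θ : Equiv.Perm (Fin (N * K))) :
      ∑ a, ∑ b, X (blowMap N K (θ a)) (blowMap N K (θ b)) = (K : ℝ) ^ 2 * ∑ i, ∑ j, X i j := by
    rw [Equiv.sum_comp θ fun a => ∑ b, X (blowMap N K a) (blowMap N K (θ b))]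
    simp_rw [fun a => Equiv.sum_comp θ fun b => X (blowMap N K a) (blowMap N K b)]
    simp_rw [fun a => hone (X (blowMap N K a))]
    rw [← Finset.mul_sum, hone fun i => ∑ j, X i j]
    ring
  simp_rw [blowAverage_apply, ← Finset.mul_sum]
  rw [Finset.sum_congr rfl fun a _ => Finset.sum_comm, Finset.sum_comm,
    Finset.sum_congr rfl fun θ _ => hθ θ, Finset.sum_const, Finset.card_univ, Fintype.card_perm,
    Fintype.card_fin, nsmul_eq_mul, inv_mul_cancel_left₀]
  exact_mod_cast (Nat.factorial_pos _).ne'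

/-- Permutation invariance makes all off-diagonal entries equal, and the diagonal entries vanish.
The common value is therefore at least the mean of all entries, which blowing up and relabeling
preserve. -/
lemma blowAverage_ge {N K : ℕ} [NeZero N] [NeZero K] {X : Matrix (Fin N) (Fin N) ℝ}
    (hdiag : ∀ i, X i i = 0) (h0 : ∀ i j, 0 ≤ X i j) {a b : Fin (N * K)} (hab : a ≠ b) :
    (∑ i, ∑ j, X i j) / (N : ℝ) ^ 2 ≤ blowAverage K X a b := by
  have hN : (0 : ℝ) < N := by exact_mod_cast NeZero.pos N
  have hK : (0 : ℝ) < K := by exact_mod_cast NeZero.pos K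
  have hy : 0 ≤ blowAverage K X a b := by
    rw [blowAverage_apply]
    exact mul_nonneg (by positivity) (Finset.sum_nonneg fun _ _ => h0 _ _)
  have hle (c d : Fin (N * K)) : blowAverage K X c d ≤ blowAverage K X a b := by
    by_cases hcd : c = d
    · subst hcd
      rw [blowAverage_apply K X c c]
      simpa [hdiag] using hy
    · obtain ⟨π, rfl, rfl⟩ := exists_perm_apply_eq_apply_eq hab hcd
      exact (blowAverage_perm K X π a b).le
  have hsum : (K : ℝ) ^ 2 * ∑ i, ∑ j, X i j ≤ ((N : ℝ) * K) ^ 2 * blowAverage K X a b := by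
    rw [← sum_blowAverage]
    calc _ ≤ ∑ _c : Fin (N * K), ∑ _d : Fin (N * K), blowAverage K X a b :=
          Finset.sum_le_sum fun c _ => Finset.sum_le_sum fun d _ => hle c d
      _ = _ := by simp; ring
  rw [div_le_iff₀ (by positivity)]
  refine le_of_mul_le_mul_left (hsum.trans_eq ?_) (pow_pos hK 2)
  ring

/-- Only injective maps are kept: they send every edge of `H` to an off-diagonal entry. -/
lemma mul_descFactorial_le_homMatrix {M : ℕ} {Z : Matrix (Fin M) (Fin M) ℝ} (hZ : Z.IsSymm)
    {c : ℝ} (hc : 0 ≤ c) (h0 : ∀ i j, 0 ≤ Z i j) (hcZ : ∀ i j, i ≠ j → c ≤ Z i j) :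
    c ^ H.edgeFinset.card * (M.descFactorial (Fintype.card V) : ℝ) ≤ homMatrix H Z hZ := by
  have hinj (φ : V ↪ Fin M) :
      c ^ H.edgeFinset.card ≤ edgeProd H Z (fun i j => hZ.apply j i) φ := by
    rw [← Finset.prod_const]
    refine Finset.prod_le_prod (fun _ _ => hc) fun e he => ?_
    induction e with | _ a b =>
      rw [SimpleGraph.mem_edgeFinset, SimpleGraph.mem_edgeSet] at he
      exact hcZ _ _ fun h => he.ne (φ.injective h)
  calc c ^ H.edgeFinset.card * (M.descFactorial (Fintype.card V) : ℝ)
      = ∑ _φ : V ↪ Fin M, c ^ H.edgeFinset.card := by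
        simp [Fintype.card_embedding_eq, mul_comm]
    _ ≤ ∑ φ : V ↪ Fin M, edgeProd H Z (fun i j => hZ.apply j i) φ :=
        Finset.sum_le_sum fun φ _ => hinj φ
    _ = ∑ φ ∈ Finset.univ.map ⟨fun φ : V ↪ Fin M => (φ : V → Fin M), DFunLike.coe_injective⟩,
          edgeProd H Z (fun i j => hZ.apply j i) φ := by rw [Finset.sum_map]; rfl
    _ ≤ homMatrix H Z hZ := Finset.sum_le_sum_of_subset_of_nonneg (Finset.subset_univ _)
        fun φ _ _ => edgeProd_nonneg H _ h0 φ

variable {H}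

/-- A seminorming graph satisfies Sidorenko's inequality for matrices with zero diagonal. -/
theorem IsSeminorming.sidorenko (hH : IsSeminorming H) {N : ℕ} [NeZero N]
    {X : Matrix (Fin N) (Fin N) ℝ} (hX : X.IsSymm) (hdiag : ∀ i, X i i = 0)
    (h0 : ∀ i j, 0 ≤ X i j) :
    ((∑ i, ∑ j, X i j) / (N : ℝ) ^ 2) ^ H.edgeFinset.card * (N : ℝ) ^ Fintype.card V ≤
      homMatrix H X hX := by
  set c := (∑ i, ∑ j, X i j) / (N : ℝ) ^ 2
  set n := Fintype.card V
  have hc0 : 0 ≤ c :=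
    div_nonneg (Finset.sum_nonneg fun i _ => Finset.sum_nonneg fun j _ => h0 i j) (by positivity)
  have hstep (K : ℕ) (hK : 0 < K) :
      c ^ H.edgeFinset.card * ((N * K).descFactorial n : ℝ) ≤
        (K : ℝ) ^ n * homMatrix H X hX := by
    have : NeZero K := ⟨hK.ne'⟩
    have : NeZero (N * K) := ⟨(Nat.mul_pos (NeZero.pos N) hK).ne'⟩
    -- Every relabeled blow-up has the same `hom_H`, so their average lies in the same convex
    -- sublevel set.
    have hmem : blowAverage K X ∈ homSublevel H (N * K) ((K : ℝ) ^ n * homMatrix H X hX) := by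
      refine (hH.convex_homSublevel (N * K) _).sum_mem (fun _ _ => by positivity) ?_ fun θ _ => ?_
      · rw [Finset.sum_const, Finset.card_univ, Fintype.card_perm, Fintype.card_fin, nsmul_eq_mul,
          mul_inv_cancel₀]
        exact_mod_cast (Nat.factorial_pos _).ne'
      · refine ⟨hX.submatrix _, ?_⟩
        rw [homMatrix_blow H hX, abs_of_nonneg]
        exact mul_nonneg (by positivity) (homMatrix_nonneg H hX h0)
    obtain ⟨hZ, hle⟩ := hmem
    refine le_trans ?_ ((le_abs_self _).trans hle)
    refine mul_descFactorial_le_homMatrix H hZ hc0 (fun i j => ?_)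
      fun i j hij => blowAverage_ge hdiag h0 hij
    rw [blowAverage_apply]
    exact mul_nonneg (by positivity) (Finset.sum_nonneg fun _ _ => h0 _ _)
  -- After division by `K ^ n`, the falling factorial of `N * K` is at least `(N - n/K) ^ n`; the
  -- loss from non-injective maps disappears as `K → ∞`.
  have hlim : Tendsto (fun K : ℕ => c ^ H.edgeFinset.card * ((N : ℝ) - n / K) ^ n) atTop
      (𝓝 (c ^ H.edgeFinset.card * ((N : ℝ) - 0) ^ n)) :=
    ((tendsto_const_nhds.sub (tendsto_const_div_atTop_nhds_zero_nat (n : ℝ))).pow n).const_mul _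
  rw [sub_zero] at hlim
  refine le_of_tendsto hlim ?_
  filter_upwards [eventually_ge_atTop (n + 1)] with K hK
  have hK0 : (0 : ℝ) < K := by exact_mod_cast (by omega : 0 < K)
  have hnK : n ≤ N * K := by nlinarith [NeZero.pos N]
  refine le_of_mul_le_mul_left ?_ (pow_pos hK0 n)
  refine le_trans ?_ (hstep K (by omega))
  rw [mul_left_comm, ← mul_pow]
  refine mul_le_mul_of_nonneg_left ?_ (by positivity)
  calc ((K : ℝ) * (N - n / K)) ^ n = ((N * K - n : ℕ) : ℝ) ^ n := by
        rw [Nat.cast_sub hnK]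
        push_cast
        congr 1
        field_simp
    _ ≤ ((N * K + 1 - n : ℕ) : ℝ) ^ n := by
        gcongr
        omega
    _ ≤ _ := by exact_mod_cast Nat.pow_sub_le_descFactorial (N * K) n

end Sidorenko

/-! ### Product measures on graphs -/

section RandomGraph

/-- The pairs of distinct vertices. -/
def vertexPairs (N : ℕ) : Finset (Sym2 (Fin N)) := Finset.univ.filter fun e => ¬ e.IsDiag

lemma mem_vertexPairs {N : ℕ} {e : Sym2 (Fin N)} : e ∈ vertexPairs N ↔ ¬ e.IsDiag := by
  simp [vertexPairs]

lemma mem_vertexPairs_of_mem_edgeSet {N : ℕ} {G : SimpleGraph (Fin N)} {e : Sym2 (Fin N)}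
    (he : e ∈ G.edgeSet) : e ∈ vertexPairs N :=
  mem_vertexPairs.2 (G.not_isDiag_of_mem_edgeSet he)

lemma card_vertexPairs (N : ℕ) : (vertexPairs N).card = N.choose 2 := by
  rw [vertexPairs, ← Fintype.card_subtype, Sym2.card_subtype_not_diag, Fintype.card_fin]

lemma sum_vertexPairs {N : ℕ} (f : Sym2 (Fin N) → ℝ) :
    ∑ e ∈ vertexPairs N, f e = ∑ i : Fin N, ∑ j ∈ Finset.Ioi i, f s(i, j) := by
  have h := Finset.sum_sym2_filter_not_isDiag (Finset.univ : Finset (Fin N)) f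
  rw [Finset.sym2_univ] at h
  rw [vertexPairs, h, Finset.sum_sigma']
  refine Finset.sum_bij' (fun z _ => ⟨z.1, z.2⟩) (fun z _ => (z.1, z.2)) ?_ ?_ ?_ ?_ ?_
  · intro z hz
    simpa using (Finset.mem_filter.1 hz).2
  · intro z hz
    have : z.1 < z.2 := by simpa using hz
    simp [this, this.ne]
  · intros; rfl
  · intros; rfl
  · intros; rfl

open scoped Classical in
/-- The weight of the graph `G` under the product measure in which the pair `e` is an edge with
weight `u e` and a non-edge with weight `w e`. -/
def productWeight {N : ℕ} (u w : Sym2 (Fin N) → ℝ) (G : SimpleGraph (Fin N)) : ℝ :=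
  ∏ e ∈ vertexPairs N, if e ∈ G.edgeSet then u e else w e

lemma productWeight_nonneg {N : ℕ} {u w : Sym2 (Fin N) → ℝ} (hu : ∀ e, 0 ≤ u e)
    (hw : ∀ e, 0 ≤ w e) (G : SimpleGraph (Fin N)) : 0 ≤ productWeight u w G := by
  refine Finset.prod_nonneg fun e _ => ?_
  split_ifs
  exacts [hu e, hw e]

/-- Expanding the product over pairs selects an edge set, and sets of non-diagonal pairs correspond
to graphs. This normalises product measures and also evaluates generating functions. -/
lemma sum_productWeight {N : ℕ} (u w : Sym2 (Fin N) → ℝ) :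
    ∑ G, productWeight u w G = ∏ e ∈ vertexPairs N, (u e + w e) := by
  classical
  rw [Finset.prod_add]
  symm
  refine Finset.sum_bij' (fun t _ => SimpleGraph.fromEdgeSet (t : Set (Sym2 (Fin N))))
    (fun G _ => (vertexPairs N).filter (· ∈ G.edgeSet)) ?_ ?_ ?_ ?_ ?_
  · intros; simp
  · intro G _
    simp
  · intro t ht
    rw [Finset.mem_powerset] at ht
    ext e
    simp only [Finset.mem_filter, SimpleGraph.edgeSet_fromEdgeSet, Set.mem_sdiff, Finset.mem_coe]
    refine ⟨fun h => h.2.1, fun h => ⟨ht h, h, ?_⟩⟩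
    simpa [Sym2.mem_diagSet] using mem_vertexPairs.1 (ht h)
  · intro G _
    conv_rhs => rw [← G.fromEdgeSet_edgeSet]
    congr 1
    ext e
    simp only [Finset.coe_filter, Set.mem_ofPred_eq]
    exact ⟨fun h => h.2, fun h => ⟨mem_vertexPairs_of_mem_edgeSet h, h⟩⟩
  · intro t ht
    rw [Finset.mem_powerset] at ht
    have hmem : ∀ e ∈ vertexPairs N,
        (e ∈ (SimpleGraph.fromEdgeSet (t : Set (Sym2 (Fin N)))).edgeSet ↔ e ∈ t) := by
      intro e he
      have : e ∉ Sym2.diagSet := by simpa [Sym2.mem_diagSet] using mem_vertexPairs.1 he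
      simp [SimpleGraph.edgeSet_fromEdgeSet, this]
    have hite : productWeight u w (SimpleGraph.fromEdgeSet (t : Set (Sym2 (Fin N)))) =
        ∏ e ∈ vertexPairs N, if e ∈ t then u e else w e :=
      Finset.prod_congr rfl fun e he => by simp only [hmem e he]
    rw [hite, Finset.prod_ite, Finset.filter_mem_eq_inter, Finset.inter_eq_right.2 ht,
      Finset.filter_notMem_eq_sdiff]

/-- The probability of the graph `G` under `G(N,q)`. -/
def graphWeight {N : ℕ} (q : ℝ) (G : SimpleGraph (Fin N)) : ℝ :=
  productWeight (fun _ => q) (fun _ => 1 - q) G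

lemma graphWeight_nonneg {N : ℕ} {q : ℝ} (h0 : 0 ≤ q) (h1 : q ≤ 1) (G : SimpleGraph (Fin N)) :
    0 ≤ graphWeight q G :=
  productWeight_nonneg (fun _ => h0) (fun _ => sub_nonneg.2 h1) G

lemma graphWeight_pos {N : ℕ} {q : ℝ} (h0 : 0 < q) (h1 : q < 1) (G : SimpleGraph (Fin N)) :
    0 < graphWeight q G := by
  unfold graphWeight productWeight
  refine Finset.prod_pos fun e _ => ?_
  split_ifs
  exacts [h0, sub_pos.2 h1]

lemma sum_graphWeight {N : ℕ} (q : ℝ) : ∑ G : SimpleGraph (Fin N), graphWeight q G = 1 := by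
  simp [graphWeight, sum_productWeight]

lemma card_filter_mem_edgeSet {N : ℕ} (G : SimpleGraph (Fin N))
    [DecidablePred (· ∈ G.edgeSet)] :
    ((vertexPairs N).filter (· ∈ G.edgeSet)).card = G.edgeSet.ncard := by
  rw [← Set.ncard_coe_finset]
  congr 1
  ext e
  simp only [Finset.coe_filter, Set.mem_ofPred_eq]
  exact ⟨fun h => h.2, fun h => ⟨mem_vertexPairs_of_mem_edgeSet h, h⟩⟩

lemma graphWeight_eq_pow {N : ℕ} (q : ℝ) (G : SimpleGraph (Fin N)) :
    graphWeight q G = q ^ G.edgeSet.ncard * (1 - q) ^ (N.choose 2 - G.edgeSet.ncard) := by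
  classical
  rw [graphWeight, productWeight, Finset.prod_ite, Finset.prod_const, Finset.prod_const,
    Finset.filter_not, Finset.card_sdiff_of_subset (Finset.filter_subset _ _),
    card_vertexPairs, card_filter_mem_edgeSet]

instance (N : ℕ) : MeasurableSingletonClass (SimpleGraph (Fin N)) where
  measurableSet_singleton G := by
    have : ({G} : Set (SimpleGraph (Fin N))) = SimpleGraph.edgeSet ⁻¹' {G.edgeSet} := by
      ext G'
      simp
    rw [this]
    exact SimpleGraph.measurable_edgeSet (measurableSet_singleton _)

lemma binomialRandom_real_singleton {N : ℕ} (p : I) (G : SimpleGraph (Fin N)) :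
    (SimpleGraph.binomialRandom (Fin N) p).real {G} = graphWeight (p : ℝ) G := by
  rw [measureReal_def, SimpleGraph.binomialRandom_singleton, graphWeight_eq_pow]
  simp

open scoped Classical in
lemma binomialRandom_real_apply {N : ℕ} (p : I) (A : Set (SimpleGraph (Fin N))) :
    (SimpleGraph.binomialRandom (Fin N) p).real A =
      ∑ G ∈ Finset.univ.filter (· ∈ A), graphWeight (p : ℝ) G := by
  simp_rw [← binomialRandom_real_singleton]
  rw [sum_measureReal_singleton]
  simp

end RandomGraph

/-! ### Relative entropy and its tangent lines -/

section RelEntropy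

lemma sub_le_mul_log_div {x p : ℝ} (hx : 0 ≤ x) (hp : 0 < p) : x - p ≤ x * Real.log (x / p) := by
  rcases hx.eq_or_lt with rfl | hx
  · simpa using hp.le
  · have h := Real.one_sub_inv_le_log_of_pos (div_pos hx hp)
    calc x - p = x * (1 - (x / p)⁻¹) := by field_simp
      _ ≤ _ := mul_le_mul_of_nonneg_left h hx.le

lemma relEntropy_nonneg {p x : ℝ} (hp0 : 0 < p) (hp1 : p < 1) (hx : x ∈ Set.Icc (0 : ℝ) 1) :
    0 ≤ relEntropy p x := by
  have h1 := sub_le_mul_log_div hx.1 hp0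
  have h2 := sub_le_mul_log_div (sub_nonneg.2 hx.2) (sub_pos.2 hp1)
  unfold relEntropy
  linarith

lemma mul_log_div_eq_add (x : ℝ) {p q : ℝ} (hp : p ≠ 0) (hq : q ≠ 0) :
    x * Real.log (x / p) = x * Real.log (x / q) + x * Real.log (q / p) := by
  rcases eq_or_ne x 0 with rfl | hx
  · simp
  · rw [Real.log_div hx hp, Real.log_div hx hq, Real.log_div hq hp]
    ring

/-- The difference between the relative entropy and its tangent line is a relative entropy. -/
lemma relEntropy_eq_tangent_add {p q : ℝ} (x : ℝ) (hp0 : 0 < p) (hp1 : p < 1) (hq0 : 0 < q)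
    (hq1 : q < 1) :
    relEntropy p x = relEntropy p q +
      (x - q) * (Real.log (q / p) - Real.log ((1 - q) / (1 - p))) + relEntropy q x := by
  unfold relEntropy
  rw [mul_log_div_eq_add x hp0.ne' hq0.ne',
    mul_log_div_eq_add (1 - x) (sub_pos.2 hp1).ne' (sub_pos.2 hq1).ne']
  ring

/-- The function on pairs of vertices given by a symmetric matrix. -/
def symEntry {N : ℕ} (X : Matrix (Fin N) (Fin N) ℝ) (hX : X.IsSymm) : Sym2 (Fin N) → ℝ :=
  Sym2.lift ⟨X, fun i j => hX.apply j i⟩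

lemma relEntropyMatrix_eq_sum {N : ℕ} (p : ℝ) {X : Matrix (Fin N) (Fin N) ℝ} (hX : X.IsSymm) :
    relEntropyMatrix p X = ∑ e ∈ vertexPairs N, relEntropy p (symEntry X hX e) := by
  rw [sum_vertexPairs]
  rfl

lemma relEntropyMatrix_nonneg {N : ℕ} {p : ℝ} (hp0 : 0 < p) (hp1 : p < 1)
    {X : Matrix (Fin N) (Fin N) ℝ} (hX : X ∈ weightMatrices N) : 0 ≤ relEntropyMatrix p X :=
  Finset.sum_nonneg fun i _ => Finset.sum_nonneg fun j _ => relEntropy_nonneg hp0 hp1 (hX.2.2 i j)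

lemma sum_sum_eq_two_mul_sum_vertexPairs {N : ℕ} {X : Matrix (Fin N) (Fin N) ℝ} (hX : X.IsSymm)
    (hdiag : ∀ i, X i i = 0) :
    ∑ i, ∑ j, X i j = 2 * ∑ e ∈ vertexPairs N, symEntry X hX e := by
  rw [sum_vertexPairs]
  have h (i j : Fin N) : X i j = (if i < j then X i j else 0) + if j < i then X j i else 0 := by
    rcases lt_trichotomy i j with h | rfl | h
    · simp [h, h.not_gt]
    · simp [hdiag]
    · simp [h, h.not_gt, hX.apply]
  have h1 : ∑ i, ∑ j, (if i < j then X i j else 0) =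
      ∑ i : Fin N, ∑ j ∈ Finset.Ioi i, symEntry X hX s(i, j) := by
    refine Finset.sum_congr rfl fun i _ => ?_
    rw [← Finset.sum_filter]
    refine Finset.sum_congr (by ext; simp) fun j _ => rfl
  rw [Finset.sum_congr rfl fun i _ => Finset.sum_congr rfl fun j _ => h i j]
  simp_rw [Finset.sum_add_distrib]
  rw [Finset.sum_comm (f := fun i j => if j < i then X j i else 0), h1]
  ring

end RelEntropy

/-! ### Entropy bound for convex events -/

section ConvexUpperBound

open scoped Classical in
/-- The probability that the adjacency matrix of `G(N,p)` lies in a convex set is at most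
`exp (-I_p(X))` for some `X` in that set. -/
theorem exists_weightMatrix_prob_le {N : ℕ} {p : I} (hp0 : 0 < (p : ℝ)) (hp1 : (p : ℝ) < 1)
    {A : Set (SimpleGraph (Fin N))} {C : Set (Matrix (Fin N) (Fin N) ℝ)} (hC : Convex ℝ C)
    (hAC : ∀ G ∈ A, G.adjMatrix ℝ ∈ C)
    (hA : 0 < (SimpleGraph.binomialRandom (Fin N) p).real A) :
    ∃ X ∈ C, X ∈ weightMatrices N ∧
      (SimpleGraph.binomialRandom (Fin N) p).real A ≤ Real.exp (-relEntropyMatrix p X) := by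
  rw [binomialRandom_real_apply] at hA ⊢
  set S : Finset (SimpleGraph (Fin N)) := Finset.univ.filter (· ∈ A)
  set P : ℝ := ∑ G ∈ S, graphWeight (p : ℝ) G
  set c : SimpleGraph (Fin N) → ℝ := fun G => graphWeight (p : ℝ) G / P
  have hc0 (G : SimpleGraph (Fin N)) : 0 < c G := div_pos (graphWeight_pos hp0 hp1 G) hA
  have hc1 : ∑ G ∈ S, c G = 1 := by rw [← Finset.sum_div, div_self hA.ne']
  -- `X` is the mean adjacency matrix of `G(N,p)` conditioned on `A`.
  set X : Matrix (Fin N) (Fin N) ℝ := ∑ G ∈ S, c G • G.adjMatrix ℝ with hXdef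
  have hXapply (i j : Fin N) : X i j = ∑ G ∈ S, c G * if G.Adj i j then 1 else 0 := by
    simp [hXdef, Matrix.sum_apply]
  have hXC : X ∈ C := hC.sum_mem (fun G _ => (hc0 G).le) hc1
    fun G hG => hAC G (Finset.mem_filter.1 hG).2
  have hXsymm : X.IsSymm := by
    ext i j
    simp_rw [Matrix.transpose_apply, hXapply, SimpleGraph.adj_comm]
  have hXW : X ∈ weightMatrices N := by
    refine ⟨hXsymm, fun i => by simp [hXapply], fun i j => ?_⟩
    rw [hXapply]
    refine ⟨Finset.sum_nonneg fun G _ => mul_nonneg (hc0 G).le (by split_ifs <;> norm_num), ?_⟩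
    refine (Finset.sum_le_sum fun G _ => ?_).trans_eq hc1
    exact mul_le_of_le_one_right (hc0 G).le (by split_ifs <;> norm_num)
  refine ⟨X, hXC, hXW, ?_⟩
  set x := symEntry X hXsymm
  have hx (e : Sym2 (Fin N)) : x e = ∑ G ∈ S, c G * if e ∈ G.edgeSet then 1 else 0 := by
    induction e with | _ i j => exact hXapply i j
  have hx' (e : Sym2 (Fin N)) : 1 - x e = ∑ G ∈ S, c G * if e ∈ G.edgeSet then 0 else 1 := by
    rw [hx, sub_eq_iff_eq_add, ← Finset.sum_add_distrib]
    refine hc1.symm.trans (Finset.sum_congr rfl fun G _ => ?_)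
    split_ifs <;> ring
  have hx0 (e : Sym2 (Fin N)) : 0 ≤ x e := by
    rw [hx]
    exact Finset.sum_nonneg fun G _ => mul_nonneg (hc0 G).le (by split_ifs <;> norm_num)
  have hx1 (e : Sym2 (Fin N)) : 0 ≤ 1 - x e := by
    rw [hx']
    exact Finset.sum_nonneg fun G _ => mul_nonneg (hc0 G).le (by split_ifs <;> norm_num)
  -- The log-density, relative to `G(N,p)`, of the product measure with edge probabilities `x`. It
  -- is affine in the edge indicators, so its conditional mean is exactly `I_p(X)`.
  set g : SimpleGraph (Fin N) → ℝ := fun G => ∑ e ∈ vertexPairs N,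
    if e ∈ G.edgeSet then Real.log (x e / p) else Real.log ((1 - x e) / (1 - p))
  have hmean : ∑ G ∈ S, c G • g G = relEntropyMatrix p X := by
    rw [relEntropyMatrix_eq_sum p hXsymm]
    simp_rw [g, smul_eq_mul, Finset.mul_sum]
    rw [Finset.sum_comm]
    refine Finset.sum_congr rfl fun e _ => ?_
    change _ = relEntropy p (x e)
    have hsplit (a b : ℝ) : x e * a + (1 - x e) * b =
        (∑ G ∈ S, c G * if e ∈ G.edgeSet then 1 else 0) * a +
          (∑ G ∈ S, c G * if e ∈ G.edgeSet then 0 else 1) * b := by rw [← hx, ← hx']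
    rw [relEntropy, hsplit, Finset.sum_mul, Finset.sum_mul, ← Finset.sum_add_distrib]
    refine Finset.sum_congr rfl fun G _ => ?_
    split_ifs <;> ring
  -- Membership in `S` keeps the logarithms away from `log 0`: a pair that is an edge of some `G ∈
  -- S` has `x e > 0`, and a non-edge has `1 - x e > 0`.
  have htilt (G : SimpleGraph (Fin N)) (hG : G ∈ S) :
      graphWeight (p : ℝ) G * Real.exp (g G) = productWeight x (fun e => 1 - x e) G := by
    simp only [graphWeight, productWeight, g]
    rw [Real.exp_sum, ← Finset.prod_mul_distrib]
    refine Finset.prod_congr rfl fun e _ => ?_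
    split_ifs with he
    · have : 0 < x e := by
        rw [hx]
        refine Finset.sum_pos' (fun G _ => mul_nonneg (hc0 G).le (by split_ifs <;> norm_num))
          ⟨G, hG, ?_⟩
        simpa [he] using hc0 G
      rw [Real.exp_log (div_pos this hp0), mul_div_cancel₀ _ hp0.ne']
    · have : 0 < 1 - x e := by
        rw [hx']
        refine Finset.sum_pos' (fun G _ => mul_nonneg (hc0 G).le (by split_ifs <;> norm_num))
          ⟨G, hG, ?_⟩
        simpa [he] using hc0 G
      rw [Real.exp_log (div_pos this (sub_pos.2 hp1)), mul_div_cancel₀ _ (sub_pos.2 hp1).ne']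
  have hjensen := convexOn_exp.map_sum_le (t := S) (w := c) (p := g) (fun G _ => (hc0 G).le) hc1
    fun _ _ => Set.mem_univ _
  rw [hmean] at hjensen
  have hle : P * Real.exp (relEntropyMatrix p X) ≤ 1 := by
    calc P * Real.exp (relEntropyMatrix p X) ≤ P * ∑ G ∈ S, c G • Real.exp (g G) :=
          mul_le_mul_of_nonneg_left hjensen hA.le
      _ = ∑ G ∈ S, productWeight x (fun e => 1 - x e) G := by
          rw [Finset.mul_sum]
          refine Finset.sum_congr rfl fun G hG => ?_
          rw [← htilt G hG, smul_eq_mul, ← mul_assoc, mul_div_cancel₀ _ hA.ne']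
      _ ≤ ∑ G, productWeight x (fun e => 1 - x e) G :=
          Finset.sum_le_sum_of_subset_of_nonneg (Finset.subset_univ _)
            fun G _ _ => productWeight_nonneg hx0 hx1 G
      _ = 1 := by simp [sum_productWeight]
  rw [Real.exp_neg, ← one_div, le_div_iff₀ (Real.exp_pos _)]
  exact hle

end ConvexUpperBound

/-! ### The two inequalities of part (1) -/

section UpperBound

variable {V : Type*} [Fintype V] [DecidableEq V] {H : SimpleGraph V} [Fintype H.edgeSet]

/-- The lower tail of `hom_H` is at most `exp (-ψ)`. -/
theorem IsSeminorming.prob_le_exp_neg_psi (hH : IsSeminorming H) {N : ℕ} [NeZero N] {p : I}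
    (hp0 : 0 < (p : ℝ)) (hp1 : (p : ℝ) < 1) (t : ℝ) :
    (SimpleGraph.binomialRandom (Fin N) p).real
        {G | homGraph H G ≤ t * (N : ℝ) ^ Fintype.card V * (p : ℝ) ^ H.edgeFinset.card} ≤
      Real.exp (-psi H N p t) := by
  classical
  set T := t * (N : ℝ) ^ Fintype.card V * (p : ℝ) ^ H.edgeFinset.card
  rcases measureReal_nonneg.eq_or_lt (a := (0 : ℝ))
    (b := (SimpleGraph.binomialRandom (Fin N) p).real {G | homGraph H G ≤ T}) with h | h
  · rw [← h]
    positivity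
  obtain ⟨X, ⟨hX, hXT⟩, hXW, hle⟩ := exists_weightMatrix_prob_le hp0 hp1
    (hH.convex_homSublevel N T) (fun G (hG : homGraph H G ≤ T) => ⟨G.isSymm_adjMatrix, by
      -- For graphs `hom_H` is nonnegative, so the one-sided event lies in the two-sided sublevel
      -- set.
      have h0 : 0 ≤ homGraph H G := homMatrix_nonneg H _ fun i j => by
        rw [SimpleGraph.adjMatrix_apply]
        split_ifs <;> norm_num
      rw [← abs_of_nonneg h0] at hG
      unfold homGraph at hG
      convert hG⟩) h
  refine hle.trans (Real.exp_le_exp.2 (neg_le_neg (csInf_le ⟨0, ?_⟩ ?_)))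
  · rintro _ ⟨Y, _, rfl⟩
    exact relEntropyMatrix_nonneg hp0 hp1 Y.2
  · exact ⟨⟨X, hXW⟩, (le_abs_self _).trans hXT, rfl⟩

/-- The `ψ` of a seminorming graph is at least its value at constant matrices. -/
theorem IsSeminorming.choose_two_mul_relEntropy_le_psi (hH : IsSeminorming H) {N : ℕ} [NeZero N]
    {p q : ℝ} (hq : 0 < q) (hqp : q < p) (hp1 : p < 1) :
    (N.choose 2 : ℝ) * relEntropy p q ≤ psi H N p (((q - q / N) / p) ^ H.edgeFinset.card) := by
  have hp0 : 0 < p := hq.trans hqp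
  have hN : (1 : ℝ) ≤ N := by exact_mod_cast NeZero.pos N
  have hqN : 0 ≤ q - q / N := sub_nonneg.2 (div_le_self hq.le hN)
  have hm := hH.card_pos
  have hT : ((q - q / N) / p) ^ H.edgeFinset.card * (N : ℝ) ^ Fintype.card V *
      p ^ H.edgeFinset.card = (q - q / N) ^ H.edgeFinset.card * (N : ℝ) ^ Fintype.card V := by
    rw [div_pow]
    field_simp
  refine le_csInf ?_ ?_
  -- The zero matrix is feasible because `H` has an edge; nonemptiness matters since `sInf ∅ = 0`.
  · refine ⟨_, ⟨0, by ext; simp, fun _ => rfl, fun _ _ => by simp⟩, ?_, rfl⟩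
    simp only [Set.mem_ofPred_eq]
    rw [hT]
    have h0 : homMatrix H (0 : Matrix (Fin N) (Fin N) ℝ) (by ext; simp) = 0 := by
      refine Finset.sum_eq_zero fun φ _ => ?_
      obtain ⟨e, he⟩ := Finset.card_pos.1 hm
      refine Finset.prod_eq_zero he ?_
      induction e with | _ a b => rfl
    rw [h0]
    positivity
  · rintro _ ⟨⟨X, hX⟩, hle, rfl⟩
    simp only [Set.mem_ofPred_eq] at hle ⊢
    rw [hT] at hle
    have hsid := (hH.sidorenko hX.1 hX.2.1 fun i j => (hX.2.2 i j).1).trans hle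
    have hsum : (∑ i, ∑ j, X i j) / (N : ℝ) ^ 2 ≤ q - q / N := by
      refine le_of_pow_le_pow_left₀ hm.ne' hqN ?_
      exact le_of_mul_le_mul_right hsid (by positivity)
    rw [sum_sum_eq_two_mul_sum_vertexPairs hX.1 hX.2.1, div_le_iff₀ (by positivity)] at hsum
    set x := symEntry X hX.1 with hx
    have hxmem (e : Sym2 (Fin N)) : x e ∈ Set.Icc (0 : ℝ) 1 := by
      induction e with | _ i j => exact hX.2.2 i j
    -- Dividing by `N ^ 2` counts the zero diagonal; the factor `1 - 1/N` in `q - q/N` compensates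
    -- exactly.
    have hmean : ∑ e ∈ vertexPairs N, (x e - q) ≤ 0 := by
      rw [Finset.sum_sub_distrib, Finset.sum_const, card_vertexPairs, nsmul_eq_mul,
        Nat.cast_choose_two]
      have : (q - q / N) * (N : ℝ) ^ 2 = 2 * (N * (N - 1) / 2 * q) := by
        field_simp
      linarith
    -- Since `q < p`, the tangent at `q` has nonpositive slope, so a mean at most `q` contributes
    -- with the right sign.
    have hslope : Real.log (q / p) - Real.log ((1 - q) / (1 - p)) ≤ 0 := by
      have h1 : Real.log (q / p) ≤ 0 :=
        Real.log_nonpos (by positivity) ((div_le_one hp0).2 hqp.le)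
      have h2 : 0 ≤ Real.log ((1 - q) / (1 - p)) :=
        Real.log_nonneg ((one_le_div (sub_pos.2 hp1)).2 (by linarith))
      linarith
    rw [relEntropyMatrix_eq_sum p hX.1, ← hx]
    calc (N.choose 2 : ℝ) * relEntropy p q
        = ∑ _e ∈ vertexPairs N, relEntropy p q := by
          rw [Finset.sum_const, card_vertexPairs, nsmul_eq_mul]
      _ ≤ ∑ _e ∈ vertexPairs N, relEntropy p q + (∑ e ∈ vertexPairs N, (x e - q)) *
            (Real.log (q / p) - Real.log ((1 - q) / (1 - p))) :=
          le_add_of_nonneg_right (mul_nonneg_of_nonpos_of_nonpos hmean hslope)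
      _ = ∑ e ∈ vertexPairs N, (relEntropy p q +
            (x e - q) * (Real.log (q / p) - Real.log ((1 - q) / (1 - p)))) := by
          rw [Finset.sum_add_distrib, Finset.sum_mul]
      _ ≤ _ := by
          refine Finset.sum_le_sum fun e _ => ?_
          rw [relEntropy_eq_tangent_add (x e) hp0 hp1 hq (hqp.trans hp1)]
          exact le_add_of_nonneg_right (relEntropy_nonneg hq (hqp.trans hp1) (hxmem e))

end UpperBound

/-! ### First moment of `hom_H` in the sparser graph -/

section FirstMoment

variable {V : Type*} [Fintype V] [DecidableEq V] (H : SimpleGraph V) [Fintype H.edgeSet]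

-- The edges at `v` all meet any one of them.
open scoped Classical in
lemma card_incident_le_maxEdgeAdj {V : Type*} (H : SimpleGraph V) [Fintype H.edgeSet] (v : V) :
    (H.edgeFinset.filter (v ∈ ·)).card ≤ maxEdgeAdj H := by
  rcases (H.edgeFinset.filter (v ∈ ·)).eq_empty_or_nonempty with h | ⟨e, he⟩
  · simp [h]
  · obtain ⟨he, hv⟩ := Finset.mem_filter.1 he
    refine le_trans (Finset.card_le_card ?_)
      (Finset.le_sup (f := fun e => (H.edgeFinset.filter fun e' => ∃ v, v ∈ e ∧ v ∈ e').card) he)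
    intro e' he'
    obtain ⟨he', hv'⟩ := Finset.mem_filter.1 he'
    exact Finset.mem_filter.2 ⟨he', v, hv, hv'⟩

lemma one_le_maxEdgeAdj {V : Type*} (H : SimpleGraph V) [Fintype H.edgeSet]
    (hm : 0 < H.edgeFinset.card) : 1 ≤ maxEdgeAdj H := by
  classical
  obtain ⟨e, he⟩ := Finset.card_pos.1 hm
  induction e with | _ a b =>
    refine le_trans (Finset.card_pos.2 ⟨s(a, b), ?_⟩) (card_incident_le_maxEdgeAdj H a)
    exact Finset.mem_filter.2 ⟨he, Sym2.mem_mk_left a b⟩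

lemma sym2_map_injOn {α β : Type*} {φ : α → β} {U : Set α} (hφ : Set.InjOn φ U) :
    Set.InjOn (Sym2.map φ) {e | ∀ v ∈ e, v ∈ U} := by
  intro e he e' he' h
  induction e with | _ a b =>
  induction e' with | _ c d =>
    have ha : a ∈ U := he a (Sym2.mem_mk_left a b)
    have hb : b ∈ U := he b (Sym2.mem_mk_right a b)
    have hc : c ∈ U := he' c (Sym2.mem_mk_left c d)
    have hd : d ∈ U := he' d (Sym2.mem_mk_right c d)
    rw [Sym2.map_mk, Sym2.map_mk, Sym2.eq_iff] at h
    rw [Sym2.eq_iff]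
    rcases h with ⟨h1, h2⟩ | ⟨h1, h2⟩
    · exact .inl ⟨hφ ha hc h1, hφ hb hd h2⟩
    · exact .inr ⟨hφ ha hd h1, hφ hb hc h2⟩

/-- A map that is injective on `U` loses at most `Δ_⋆` edges for every vertex outside of `U`. -/
lemma card_edgeFinset_le_card_image_add {N : ℕ} (φ : V → Fin N) (U : Finset V)
    (hφ : Set.InjOn φ U) :
    H.edgeFinset.card ≤ (H.edgeFinset.image (Sym2.map φ)).card + Uᶜ.card * maxEdgeAdj H := by
  classical
  set E₁ := H.edgeFinset.filter fun e => ∀ v ∈ e, v ∈ U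
  have hsub : H.edgeFinset ⊆ E₁ ∪ Uᶜ.biUnion fun v => H.edgeFinset.filter (v ∈ ·) := by
    intro e he
    by_cases h : ∀ v ∈ e, v ∈ U
    · exact Finset.mem_union_left _ (Finset.mem_filter.2 ⟨he, h⟩)
    · push Not at h
      obtain ⟨v, hv, hvU⟩ := h
      exact Finset.mem_union_right _ (Finset.mem_biUnion.2
        ⟨v, Finset.mem_compl.2 hvU, Finset.mem_filter.2 ⟨he, hv⟩⟩)
  refine (Finset.card_le_card hsub).trans ((Finset.card_union_le _ _).trans (add_le_add ?_ ?_))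
  · have hinj : Set.InjOn (Sym2.map φ) E₁ :=
      (sym2_map_injOn hφ).mono fun e he => (Finset.mem_filter.1 he).2
    rw [← Finset.card_image_of_injOn hinj]
    exact Finset.card_le_card (Finset.image_subset_image (Finset.filter_subset _ _))
  · refine Finset.card_biUnion_le_card_mul _ _ _ fun v _ => ?_
    convert card_incident_le_maxEdgeAdj H v

open scoped Classical in
lemma sum_graphWeight_mul_edgeProd_le {V : Type*} (H : SimpleGraph V) [Fintype H.edgeSet]
    {N : ℕ} {q : ℝ} (hq0 : 0 ≤ q) (hq1 : q ≤ 1) (φ : V → Fin N) :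
    ∑ G : SimpleGraph (Fin N), graphWeight q G *
        edgeProd H (G.adjMatrix ℝ) (fun i j => G.isSymm_adjMatrix.apply j i) φ ≤
      q ^ (H.edgeFinset.image (Sym2.map φ)).card := by
  set S := H.edgeFinset.image (Sym2.map φ)
  have hfac (G : SimpleGraph (Fin N)) (e : Sym2 V) :
      Sym2.lift ⟨G.adjMatrix ℝ, fun i j => G.isSymm_adjMatrix.apply j i⟩ (e.map φ) =
        if e.map φ ∈ G.edgeSet then 1 else 0 := by
    induction e with | _ a b => simp [SimpleGraph.adjMatrix_apply]
  have hzero (G : SimpleGraph (Fin N)) (hG : ¬ ∀ f ∈ S, f ∈ G.edgeSet) :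
      edgeProd H (G.adjMatrix ℝ) (fun i j => G.isSymm_adjMatrix.apply j i) φ = 0 := by
    push Not at hG
    obtain ⟨f, hf, hfG⟩ := hG
    obtain ⟨e, he, rfl⟩ := Finset.mem_image.1 hf
    exact Finset.prod_eq_zero he (by rw [hfac, if_neg hfG])
  by_cases hS : S ⊆ vertexPairs N
  -- Giving non-edges in `S` weight zero restricts the product measure to graphs containing `S`.
  · have hw0 (e : Sym2 (Fin N)) : 0 ≤ if e ∈ S then 0 else 1 - q := by
      split_ifs
      exacts [le_rfl, sub_nonneg.2 hq1]
    calc _ ≤ ∑ G : SimpleGraph (Fin N),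
          productWeight (fun _ => q) (fun e => if e ∈ S then 0 else 1 - q) G := by
          refine Finset.sum_le_sum fun G _ => ?_
          by_cases hG : ∀ f ∈ S, f ∈ G.edgeSet
          · have h1 : edgeProd H (G.adjMatrix ℝ) (fun i j => G.isSymm_adjMatrix.apply j i) φ = 1 :=
              Finset.prod_eq_one fun e he => by
                rw [hfac, if_pos (hG _ (Finset.mem_image_of_mem _ he))]
            rw [h1, mul_one]
            unfold graphWeight productWeight
            refine (Finset.prod_congr rfl fun e _ => ?_).le
            by_cases he : e ∈ G.edgeSet
            · simp only [if_pos he]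
            · simp only [if_neg he, if_neg fun h => he (hG e h)]
          · rw [hzero G hG, mul_zero]
            exact productWeight_nonneg (fun _ => hq0) hw0 G
      _ = ∏ e ∈ vertexPairs N, if e ∈ S then q else 1 := by
          rw [sum_productWeight]
          refine Finset.prod_congr rfl fun e _ => ?_
          split_ifs <;> ring
      _ = q ^ S.card := by
          rw [Finset.prod_ite, Finset.prod_const, Finset.prod_const_one, mul_one,
            Finset.filter_mem_eq_inter, Finset.inter_eq_right.2 hS]
  · rw [Finset.sum_eq_zero]
    · positivity
    · intro G _
      rw [hzero G, mul_zero]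
      exact fun h => hS fun f hf => mem_vertexPairs_of_mem_edgeSet (h f hf)

/-- Such a map is determined by its values on `U` and, for each vertex outside `U`, a vertex of `U`
with the same image. -/
lemma card_filter_range_eq_image_le {N : ℕ} (U : Finset V) :
    (Finset.univ.filter fun φ : V → Fin N => ∀ v, ∃ u ∈ U, φ u = φ v).card ≤
      N ^ U.card * Fintype.card V ^ Uᶜ.card := by
  let F : (U → Fin N) × ({v // v ∈ Uᶜ} → U) → V → Fin N := fun z v =>
    if h : v ∈ U then z.1 ⟨v, h⟩ else z.1 (z.2 ⟨v, Finset.mem_compl.2 h⟩)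
  have hsub : (Finset.univ.filter fun φ : V → Fin N => ∀ v, ∃ u ∈ U, φ u = φ v) ⊆
      Finset.univ.image F := by
    intro φ hφ
    choose g hgU hg using (Finset.mem_filter.1 hφ).2
    refine Finset.mem_image.2 ⟨(fun u => φ u, fun v => ⟨g v, hgU v⟩), Finset.mem_univ _, ?_⟩
    funext v
    by_cases h : v ∈ U <;> simp [F, h, hg]
  refine (Finset.card_le_card hsub).trans (Finset.card_image_le.trans ?_)
  rw [Finset.card_univ, Fintype.card_prod, Fintype.card_fun, Fintype.card_fun, Fintype.card_fin,
    Fintype.card_coe, Fintype.card_coe]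
  gcongr
  exact Finset.card_le_univ U

/-- An upper bound for the expectation of `hom_H(G(N,q))`. -/
theorem sum_graphWeight_mul_homGraph_le {N : ℕ} {q : ℝ} (hq0 : 0 < q) (hq1 : q ≤ 1) :
    ∑ G : SimpleGraph (Fin N), graphWeight q G * homGraph H G ≤
      q ^ H.edgeFinset.card *
        (N + Fintype.card V * (q ^ maxEdgeAdj H)⁻¹) ^ Fintype.card V := by
  classical
  set r := (q ^ maxEdgeAdj H)⁻¹ with hr
  have hr0 : 0 < r := by positivity
  have hbound (φ : V → Fin N) (U : Finset V) (hφ : Set.InjOn φ U) :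
      q ^ (H.edgeFinset.image (Sym2.map φ)).card ≤ q ^ H.edgeFinset.card * r ^ Uᶜ.card := by
    rw [hr, inv_pow, ← div_eq_mul_inv, le_div_iff₀ (by positivity), ← pow_mul, ← pow_add]
    refine pow_le_pow_of_le_one hq0.le hq1 ?_
    rw [mul_comm]
    exact card_edgeFinset_le_card_image_add H φ U hφ
  -- `U` picks one vertex from each nonempty fibre of `φ`.
  have htrans (φ : V → Fin N) :
      ∃ U : Finset V, Set.InjOn φ U ∧ ∀ v, ∃ u ∈ U, φ u = φ v := by
    obtain ⟨U, -, hU⟩ := Set.exists_subset_bijOn (Set.univ : Set V) φ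
    refine ⟨U.toFinset, by simpa using hU.injOn, fun v => ?_⟩
    have : φ v ∈ φ '' U := hU.image_eq ▸ ⟨v, Set.mem_univ v, rfl⟩
    obtain ⟨u, hu, huv⟩ := this
    exact ⟨u, by simpa using hu, huv⟩
  calc ∑ G : SimpleGraph (Fin N), graphWeight q G * homGraph H G
      = ∑ φ : V → Fin N, ∑ G : SimpleGraph (Fin N), graphWeight q G *
          edgeProd H (G.adjMatrix ℝ) (fun i j => G.isSymm_adjMatrix.apply j i) φ := by
        rw [Finset.sum_comm]
        refine Finset.sum_congr rfl fun G _ => ?_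
        rw [← Finset.mul_sum]
        unfold homGraph homMatrix
        congr!
    _ ≤ ∑ φ : V → Fin N, q ^ (H.edgeFinset.image (Sym2.map φ)).card :=
        Finset.sum_le_sum fun φ _ => sum_graphWeight_mul_edgeProd_le H hq0.le hq1 φ
    -- Summing over all sets `U` that meet every nonempty fibre overcounts, but lets the sums be
    -- exchanged and collapsed by the binomial theorem.
    _ ≤ ∑ φ : V → Fin N, ∑ U : Finset V, if ∀ v, ∃ u ∈ U, φ u = φ v then
          q ^ H.edgeFinset.card * r ^ Uᶜ.card else 0 := by
        refine Finset.sum_le_sum fun φ _ => ?_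
        obtain ⟨U, hU, hU'⟩ := htrans φ
        refine (hbound φ U hU).trans ?_
        refine le_trans (by rw [if_pos hU']) (Finset.single_le_sum (f := fun U : Finset V =>
          if ∀ v, ∃ u ∈ U, φ u = φ v then q ^ H.edgeFinset.card * r ^ Uᶜ.card else 0)
          (fun U _ => ?_) (Finset.mem_univ U))
        split_ifs <;> positivity
    _ = ∑ U : Finset V, ((Finset.univ.filter fun φ : V → Fin N =>
          ∀ v, ∃ u ∈ U, φ u = φ v).card : ℝ) * (q ^ H.edgeFinset.card * r ^ Uᶜ.card) := by
        rw [Finset.sum_comm]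
        refine Finset.sum_congr rfl fun U _ => ?_
        rw [← Finset.sum_filter, Finset.sum_const, nsmul_eq_mul]
    _ ≤ ∑ U : Finset V, ((N : ℝ) ^ U.card * (Fintype.card V : ℝ) ^ Uᶜ.card) *
          (q ^ H.edgeFinset.card * r ^ Uᶜ.card) := by
        refine Finset.sum_le_sum fun U _ => mul_le_mul_of_nonneg_right ?_ (by positivity)
        exact_mod_cast card_filter_range_eq_image_le (N := N) U
    _ = q ^ H.edgeFinset.card * (N + Fintype.card V * r) ^ Fintype.card V := by
        rw [← Fintype.sum_pow_mul_eq_add_pow V (N : ℝ) (Fintype.card V * r), Finset.mul_sum]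
        refine Finset.sum_congr rfl fun U _ => ?_
        rw [Finset.card_compl, mul_pow]
        ring

open scoped Classical in
/-- Markov's inequality for `hom_H(G(N,q))`. -/
lemma one_sub_div_le_sum_graphWeight {N : ℕ} {q T : ℝ} (hq0 : 0 < q) (hq1 : q ≤ 1) (hT : 0 < T) :
    1 - q ^ H.edgeFinset.card *
        (N + Fintype.card V * (q ^ maxEdgeAdj H)⁻¹) ^ Fintype.card V / T ≤
      ∑ G ∈ Finset.univ.filter (· ∈ {G : SimpleGraph (Fin N) | homGraph H G ≤ T}),
        graphWeight q G := by
  have hnonneg (G : SimpleGraph (Fin N)) : 0 ≤ homGraph H G := homMatrix_nonneg H _ fun i j => by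
    rw [SimpleGraph.adjMatrix_apply]
    split_ifs <;> norm_num
  have hw := graphWeight_nonneg (N := N) hq0.le hq1
  rw [sub_le_iff_le_add, ← sum_graphWeight (N := N) q,
    ← Finset.sum_filter_add_sum_filter_not Finset.univ
      (· ∈ {G : SimpleGraph (Fin N) | homGraph H G ≤ T}) (graphWeight q), add_le_add_iff_left,
    le_div_iff₀ hT]
  refine le_trans ?_ (sum_graphWeight_mul_homGraph_le H hq0 hq1)
  rw [Finset.sum_mul]
  refine le_trans (Finset.sum_le_sum fun G hG => ?_) (Finset.sum_le_sum_of_subset_of_nonneg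
    (Finset.subset_univ _) fun G _ _ => mul_nonneg (hw G) (hnonneg G))
  have : ¬ homGraph H G ≤ T := (Finset.mem_filter.1 hG).2
  exact mul_le_mul_of_nonneg_left (not_le.1 this).le (hw G)

end FirstMoment

/-! ### Edge-count concentration and change of measure -/

section Tilting

lemma ncard_edgeSet_le_choose {N : ℕ} (G : SimpleGraph (Fin N)) :
    G.edgeSet.ncard ≤ N.choose 2 := by
  classical
  rw [← card_filter_mem_edgeSet, ← card_vertexPairs]
  exact Finset.card_filter_le _ _

open scoped Classical in
/-- A Chernoff bound for the lower tail of the number of edges of `G(N,q)`. -/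
lemma sum_graphWeight_few_edges_le {N : ℕ} {q γ : ℝ} (hq0 : 0 ≤ q) (hq1 : q ≤ 1) (hγ0 : 0 ≤ γ)
    (hγ1 : γ ≤ 1) :
    ∑ G ∈ Finset.univ.filter fun G : SimpleGraph (Fin N) =>
        (G.edgeSet.ncard : ℝ) < (1 - γ) * (N.choose 2 * q), graphWeight q G ≤
      Real.exp (-(N.choose 2 * q * γ ^ 2 / 4)) := by
  set M : ℝ := (N.choose 2 : ℝ) * q
  have hM : 0 ≤ M := by positivity
  -- The Chernoff parameter `γ / 2` minimises `t ^ 2 - γ * t`, giving the exponent `-γ ^ 2 / 4`.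
  have hexp : Real.exp (-(γ / 2)) ≤ 1 - γ / 2 + (γ / 2) ^ 2 := by
    have h := Real.abs_exp_sub_one_sub_id_le (x := -(γ / 2))
      (by rw [abs_neg, abs_of_nonneg (by linarith)]; linarith)
    have := (abs_le.1 h).2
    rw [neg_sq] at this
    linarith
  have hmgf : ∑ G : SimpleGraph (Fin N),
      graphWeight q G * Real.exp (-(γ / 2) * G.edgeSet.ncard) ≤
        Real.exp (M * (-(γ / 2) + (γ / 2) ^ 2)) := by
    have h1 (G : SimpleGraph (Fin N)) : graphWeight q G * Real.exp (-(γ / 2) * G.edgeSet.ncard) =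
        productWeight (fun _ => q * Real.exp (-(γ / 2))) (fun _ => 1 - q) G := by
      rw [← card_filter_mem_edgeSet, graphWeight, productWeight, productWeight, Finset.prod_ite,
        Finset.prod_ite, Finset.prod_const, Finset.prod_const, Finset.prod_const, mul_pow,
        ← Real.exp_nat_mul]
      ring_nf
    rw [Finset.sum_congr rfl fun G _ => h1 G, sum_productWeight, Finset.prod_const,
      card_vertexPairs]
    have h2 : q * Real.exp (-(γ / 2)) + (1 - q) ≤ Real.exp (q * (-(γ / 2) + (γ / 2) ^ 2)) := by
      refine le_trans ?_ (Real.add_one_le_exp _)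
      nlinarith [mul_le_mul_of_nonneg_left hexp hq0]
    refine (pow_le_pow_left₀ ?_ h2 _).trans_eq ?_
    · have := sub_nonneg.2 hq1
      positivity
    · rw [← Real.exp_nat_mul]
      ring_nf
      simp only [M]
      ring_nf
  have hw := graphWeight_nonneg (N := N) hq0 hq1
  have hmarkov : (∑ G ∈ Finset.univ.filter fun G : SimpleGraph (Fin N) =>
      (G.edgeSet.ncard : ℝ) < (1 - γ) * M, graphWeight q G) *
        Real.exp (-(γ / 2) * ((1 - γ) * M)) ≤ Real.exp (M * (-(γ / 2) + (γ / 2) ^ 2)) := by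
    refine le_trans ?_ hmgf
    rw [Finset.sum_mul]
    refine le_trans (Finset.sum_le_sum fun G hG => ?_) (Finset.sum_le_sum_of_subset_of_nonneg
      (Finset.subset_univ _) fun G _ _ => mul_nonneg (hw G) (Real.exp_pos _).le)
    refine mul_le_mul_of_nonneg_left (Real.exp_le_exp.2 ?_) (hw G)
    have : (G.edgeSet.ncard : ℝ) < (1 - γ) * M := (Finset.mem_filter.1 hG).2
    nlinarith
  rw [← le_div_iff₀ (Real.exp_pos _), ← Real.exp_sub] at hmarkov
  refine hmarkov.trans_eq ?_
  congr 1
  ring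

open scoped Classical in
/-- Change of measure from `G(N,p)` to the sparser `G(N,q)`. -/
theorem tilted_lower_bound {N : ℕ} {p : I} {q γ : ℝ} (hq0 : 0 < q) (hqp : q < (p : ℝ))
    (hp1 : (p : ℝ) < 1) (hγ0 : 0 ≤ γ) (hγ1 : γ ≤ 1) (A : Set (SimpleGraph (Fin N))) :
    (∑ G ∈ Finset.univ.filter (· ∈ A), graphWeight q G -
        Real.exp (-(N.choose 2 * q * γ ^ 2 / 4))) *
      Real.exp (-(N.choose 2 * (relEntropy p q +
        γ * q * (Real.log (p / q) + Real.log ((1 - q) / (1 - p)))))) ≤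
      (SimpleGraph.binomialRandom (Fin N) p).real A := by
  have hp0 : 0 < (p : ℝ) := hq0.trans hqp
  have hq1 : q < 1 := hqp.trans hp1
  have h1p : 0 < 1 - (p : ℝ) := sub_pos.2 hp1
  have h1q : 0 < 1 - q := sub_pos.2 hq1
  set a := Real.log (p / q) with ha
  set b := Real.log ((1 - q) / (1 - p)) with hb
  have ha0 : 0 ≤ a := Real.log_nonneg ((one_le_div hq0).2 hqp.le)
  have hb0 : 0 ≤ b := Real.log_nonneg ((one_le_div h1p).2 (by linarith))
  have hI : relEntropy p q = b - q * (a + b) := by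
    have : Real.log (q / p) = -a := by rw [ha, ← Real.log_inv, inv_div]
    rw [relEntropy, this]
    ring
  rw [binomialRandom_real_apply]
  set B := Finset.univ.filter fun G : SimpleGraph (Fin N) =>
    (G.edgeSet.ncard : ℝ) < (1 - γ) * (N.choose 2 * q)
  -- The log-density of `G(N,p)` against `G(N,q)` increases with the number of edges, so only graphs
  -- with too few edges must be discarded.
  have hdens (G : SimpleGraph (Fin N)) (hG : G ∉ B) :
      graphWeight q G * Real.exp (-(N.choose 2 * (relEntropy p q + γ * q * (a + b)))) ≤
        graphWeight (p : ℝ) G := by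
    have hG' : (1 - γ) * (N.choose 2 * q) ≤ G.edgeSet.ncard := by
      simpa [B] using hG
    have hpw : graphWeight (p : ℝ) G =
        graphWeight q G * Real.exp (G.edgeSet.ncard * a - (N.choose 2 - G.edgeSet.ncard) * b) := by
      rw [graphWeight_eq_pow, graphWeight_eq_pow, Real.exp_sub, Real.exp_nat_mul, ha,
        Real.exp_log (div_pos hp0 hq0), ← Nat.cast_sub (ncard_edgeSet_le_choose G),
        Real.exp_nat_mul, hb, Real.exp_log (div_pos h1q h1p), div_pow, div_pow]
      field_simp
    rw [hpw]
    refine mul_le_mul_of_nonneg_left (Real.exp_le_exp.2 ?_) (graphWeight_nonneg hq0.le hq1.le G)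
    rw [hI]
    nlinarith [mul_le_mul_of_nonneg_right hG' (add_nonneg ha0 hb0)]
  have hsplit : ∑ G ∈ Finset.univ.filter (· ∈ A), graphWeight q G -
      Real.exp (-(N.choose 2 * q * γ ^ 2 / 4)) ≤
        ∑ G ∈ Finset.univ.filter (· ∈ A) \ B, graphWeight q G := by
    rw [sub_le_iff_le_add]
    refine le_trans ?_ (add_le_add_right
      (sum_graphWeight_few_edges_le (N := N) hq0.le hq1.le hγ0 hγ1) _)
    rw [← Finset.sum_union Finset.sdiff_disjoint, Finset.sdiff_union_self_eq_union]
    exact Finset.sum_le_sum_of_subset_of_nonneg Finset.subset_union_left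
      fun G _ _ => graphWeight_nonneg hq0.le hq1.le G
  refine (mul_le_mul_of_nonneg_right hsplit (Real.exp_pos _).le).trans ?_
  rw [Finset.sum_mul]
  refine le_trans (Finset.sum_le_sum fun G hG => hdens G (Finset.mem_sdiff.1 hG).2)
    (Finset.sum_le_sum_of_subset_of_nonneg Finset.sdiff_subset
      fun G _ _ => graphWeight_nonneg hp0.le hp1.le G)

end Tilting

/-! ### Asymptotics and the choice of `ε` -/

section Asymptotics

/-- The constant in the lower bound `relEntropy p (s * p) ≥ p * entropyRate s`. -/
def entropyRate (s : ℝ) : ℝ := s * Real.log s + 1 - s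

lemma entropyRate_pos {s : ℝ} (hs0 : 0 < s) (hs1 : s < 1) : 0 < entropyRate s := by
  have h := Real.log_lt_sub_one_of_pos (inv_pos.2 hs0) (by simpa using hs1.ne)
  rw [Real.log_inv] at h
  have h' := mul_lt_mul_of_pos_left h hs0
  rw [mul_sub, mul_inv_cancel₀ hs0.ne'] at h'
  unfold entropyRate
  linarith

lemma mul_entropyRate_le_relEntropy {p s : ℝ} (hp0 : 0 < p) (hp1 : p < 1) (hs1 : s < 1) :
    p * entropyRate s ≤ relEntropy p (s * p) := by
  have h := sub_le_mul_log_div (x := 1 - s * p) (by nlinarith) (sub_pos.2 hp1)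
  unfold relEntropy entropyRate
  rw [mul_div_cancel_right₀ _ hp0.ne']
  linarith

lemma slope_le {p s ε : ℝ} (hp0 : 0 < p) (hp : p ≤ 1 / 2) (hs0 : 0 < s) (hs1 : s < 1)
    (hε0 : 0 < ε) (hε : ε ≤ 1 / 2) :
    Real.log (p / ((1 - ε) * (s * p))) + Real.log ((1 - (1 - ε) * (s * p)) / (1 - p)) ≤
      Real.log (4 / s) := by
  have h1ε : 0 < 1 - ε := by linarith
  have hq : 0 < (1 - ε) * (s * p) := by positivity
  have hq1 : (1 - ε) * (s * p) < 1 := by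
    have : s * p < 1 := by nlinarith
    nlinarith [mul_pos hs0 hp0]
  have h1 : p / ((1 - ε) * (s * p)) ≤ 2 / s := by
    rw [div_le_div_iff₀ hq hs0]
    nlinarith [mul_pos hs0 hp0]
  have h2 : (1 - (1 - ε) * (s * p)) / (1 - p) ≤ 2 := by
    rw [div_le_iff₀ (by linarith)]
    linarith
  calc _ ≤ Real.log (2 / s) + Real.log 2 :=
        add_le_add (Real.log_le_log (by positivity) h1)
          (Real.log_le_log (div_pos (by linarith) (by linarith)) h2)
    _ = Real.log (4 / s) := by
        rw [← Real.log_mul (by positivity) (by norm_num)]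
        congr 1
        ring

/-- Replacing `s * p` by `(1 - ε) * (s * p)` changes the exponent by a factor `1 + O(ε)`. -/
lemma tilted_exponent_le {p s ε : ℝ} (hp0 : 0 < p) (hp : p ≤ 1 / 2) (hs0 : 0 < s) (hs1 : s < 1)
    (hε0 : 0 < ε) (hε : ε ≤ 1 / 2) :
    relEntropy p ((1 - ε) * (s * p)) + ε * ((1 - ε) * (s * p)) *
        (Real.log (p / ((1 - ε) * (s * p))) + Real.log ((1 - (1 - ε) * (s * p)) / (1 - p))) ≤
      (1 + ε * (2 * Real.log (4 / s) / entropyRate s)) * relEntropy p (s * p) := by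
  have h1ε : 0 < 1 - ε := by linarith
  have hsp : 0 < s * p := mul_pos hs0 hp0
  have hspp : s * p < p := by nlinarith
  set q := (1 - ε) * (s * p) with hq
  have hq0 : 0 < q := by positivity
  have hqsp : q ≤ s * p := by nlinarith
  have hslope : Real.log (p / q) + Real.log ((1 - q) / (1 - p)) ≤ Real.log (4 / s) :=
    slope_le hp0 hp hs0 hs1 hε0 hε
  set κ := Real.log (p / q) + Real.log ((1 - q) / (1 - p)) with hκ
  have hκ0 : 0 ≤ Real.log (4 / s) := Real.log_nonneg (by rw [le_div_iff₀ hs0]; linarith)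
  have hc := entropyRate_pos hs0 hs1
  -- The tangent at `q`, evaluated at `s * p`, bounds `I_p(q) - I_p(s * p)` by `(s * p - q) * κ`.
  have htan := relEntropy_eq_tangent_add (s * p) hp0 (by linarith) hq0 (by linarith)
  have hlog : Real.log (q / p) - Real.log ((1 - q) / (1 - p)) = -κ := by
    rw [hκ, ← inv_div p q, Real.log_inv]
    ring
  rw [hlog] at htan
  have hnn : 0 ≤ relEntropy q (s * p) :=
    relEntropy_nonneg hq0 (by linarith) ⟨hsp.le, by linarith⟩
  have hdiff : s * p - q = ε * (s * p) := by rw [hq]; ring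
  have hmain : relEntropy p q + ε * q * κ ≤
      relEntropy p (s * p) + ε * (2 * Real.log (4 / s)) * p := by
    have h1 : (s * p - q + ε * q) * κ ≤ (s * p - q + ε * q) * Real.log (4 / s) := by
      refine mul_le_mul_of_nonneg_left hslope ?_
      rw [hdiff]
      positivity
    have h2 : (s * p - q + ε * q) * Real.log (4 / s) ≤ (ε * (2 * p)) * Real.log (4 / s) := by
      refine mul_le_mul_of_nonneg_right ?_ hκ0
      rw [hdiff]
      nlinarith
    linarith
  refine hmain.trans ?_
  have hI := mul_entropyRate_le_relEntropy hp0 (by linarith) hs1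
  have : ε * (2 * Real.log (4 / s)) * p =
      ε * (2 * Real.log (4 / s) / entropyRate s) * (p * entropyRate s) := by
    field_simp
  rw [this, one_add_mul]
  exact add_le_add_right (mul_le_mul_of_nonneg_left hI (by positivity)) _

variable {p : ℕ → I} {D : ℕ}

lemma eventually_pos_of_isLittleO {a : ℝ}
    (hp : (fun N : ℕ => (N : ℝ) ^ a) =o[atTop] fun N : ℕ => (p N : ℝ)) :
    ∀ᶠ N : ℕ in atTop, 0 < (p N : ℝ) := by
  filter_upwards [hp.bound one_pos, eventually_gt_atTop 0] with N h hN
  have h1 : (0 : ℝ) < (N : ℝ) ^ a := Real.rpow_pos_of_pos (by exact_mod_cast hN) _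
  rw [Real.norm_of_nonneg h1.le, Real.norm_of_nonneg (p N).2.1, one_mul] at h
  exact h1.trans_le h

/-- The case `k = 2D - 1` is the hypothesis raised to that power; smaller `k` follow from `p ≤ 1`.
It is applied with `k = 1` and `k = Δ_⋆`. -/
lemma tendsto_nat_mul_pow_atTop (hD : 1 ≤ D)
    (hp : (fun N : ℕ => (N : ℝ) ^ (-1 / (2 * (D : ℝ) - 1))) =o[atTop] fun N : ℕ => (p N : ℝ))
    {k : ℕ} (hk : k ≤ 2 * D - 1) :
    Tendsto (fun N : ℕ => (N : ℝ) * (p N : ℝ) ^ k) atTop atTop := by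
  refine tendsto_atTop.2 fun K => ?_
  set L := max K 1
  have hL : 1 ≤ L := le_max_right _ _
  have hL0 : 0 < L := by linarith
  filter_upwards [hp.bound (inv_pos.2 hL0), eventually_gt_atTop 0] with N h hN
  have hN0 : (0 : ℝ) < N := by exact_mod_cast hN
  have h1 : (0 : ℝ) < (N : ℝ) ^ (-1 / (2 * (D : ℝ) - 1)) := Real.rpow_pos_of_pos hN0 _
  rw [Real.norm_of_nonneg h1.le, Real.norm_of_nonneg (p N).2.1] at h
  have h2 : L * (N : ℝ) ^ (-1 / (2 * (D : ℝ) - 1)) ≤ p N := by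
    have := mul_le_mul_of_nonneg_left h hL0.le
    rwa [mul_inv_cancel_left₀ hL0.ne'] at this
  have hcast : ((2 * D - 1 : ℕ) : ℝ) = 2 * (D : ℝ) - 1 := by
    rw [Nat.cast_sub (by omega)]
    push_cast
    ring
  have hD' : 2 * (D : ℝ) - 1 ≠ 0 := by
    have : (1 : ℝ) ≤ D := by exact_mod_cast hD
    linarith
  have h3 : ((N : ℝ) ^ (-1 / (2 * (D : ℝ) - 1))) ^ (2 * D - 1) = (N : ℝ)⁻¹ := by
    rw [← Real.rpow_mul_natCast hN0.le, hcast, div_mul_cancel₀ _ hD', Real.rpow_neg_one]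
  calc K ≤ L := le_max_left _ _
    _ ≤ L ^ (2 * D - 1) := le_self_pow₀ hL (by omega)
    _ = N * (L * (N : ℝ) ^ (-1 / (2 * (D : ℝ) - 1))) ^ (2 * D - 1) := by
        rw [mul_pow, h3]
        field_simp
    _ ≤ N * (p N : ℝ) ^ (2 * D - 1) := by gcongr
    _ ≤ N * (p N : ℝ) ^ k := mul_le_mul_of_nonneg_left
        (pow_le_pow_of_le_one (p N).2.1 (p N).2.2 hk) hN0.le

lemma tendsto_choose_two_mul_atTop
    (hp : Tendsto (fun N : ℕ => (N : ℝ) * (p N : ℝ)) atTop atTop) :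
    Tendsto (fun N : ℕ => (N.choose 2 : ℝ) * (p N : ℝ)) atTop atTop := by
  refine tendsto_atTop_mono' atTop ?_ (hp.const_mul_atTop (by norm_num : (0 : ℝ) < 1 / 2))
  filter_upwards [eventually_ge_atTop 2] with N hN
  have hN' : (2 : ℝ) ≤ N := by exact_mod_cast hN
  rw [← mul_assoc, Nat.cast_choose_two]
  refine mul_le_mul_of_nonneg_right ?_ (p N).2.1
  nlinarith

variable {V : Type*} [Fintype V] (H : SimpleGraph V) [Fintype H.edgeSet]

/-- The ratio in Markov's inequality for `G(N, (1 - ε) s p)` is eventually at most `1 - ε / 2`. -/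
lemma eventually_markov_ratio_le {s ε : ℝ} (hm : 0 < H.edgeFinset.card) (hs0 : 0 < s)
    (hε0 : 0 < ε) (hε : ε ≤ 1 / 2) (hp0 : ∀ᶠ N : ℕ in atTop, 0 < (p N : ℝ))
    (hp : Tendsto (fun N : ℕ => (N : ℝ) * (p N : ℝ) ^ maxEdgeAdj H) atTop atTop) :
    ∀ᶠ N : ℕ in atTop,
      ((1 - ε) * (s * p N)) ^ H.edgeFinset.card *
          (N + Fintype.card V * (((1 - ε) * (s * p N)) ^ maxEdgeAdj H)⁻¹) ^ Fintype.card V /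
        ((s * p N - s * p N / N) ^ H.edgeFinset.card * (N : ℝ) ^ Fintype.card V) ≤ 1 - ε / 2 := by
  have h1ε : 0 < 1 - ε := by linarith
  set m := H.edgeFinset.card
  set n := Fintype.card V
  set k := maxEdgeAdj H
  have hlim1 : Tendsto (fun N : ℕ => (1 - ε) ^ m / (1 - 1 / (N : ℝ)) ^ m) atTop
      (𝓝 ((1 - ε) ^ m / (1 - 0) ^ m)) :=
    tendsto_const_nhds.div ((tendsto_const_nhds.sub tendsto_one_div_atTop_nhds_zero_nat).pow m)
      (by simp)
  have hlim2 : Tendsto (fun N : ℕ => (1 + n / (((1 - ε) * s) ^ k * ((N : ℝ) * (p N : ℝ) ^ k))) ^ n)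
      atTop (𝓝 ((1 + 0) ^ n)) :=
    (tendsto_const_nhds.add (tendsto_const_nhds.div_atTop
      (hp.const_mul_atTop (by positivity)))).pow n
  have hlim := hlim1.mul hlim2
  simp only [sub_zero, one_pow, div_one, add_zero, mul_one] at hlim
  -- The ratio tends to `(1 - ε) ^ m ≤ 1 - ε`, as `m ≥ 1`.
  have hlt : (1 - ε) ^ m < 1 - ε / 2 :=
    (pow_le_of_le_one h1ε.le (by linarith) hm.ne').trans_lt (by linarith)
  filter_upwards [hlim.eventually_le_const hlt, hp0, eventually_ge_atTop 2] with N h hpN hN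
  refine le_trans (le_of_eq ?_) h
  have hN' : (2 : ℝ) ≤ N := by exact_mod_cast hN
  have hN0 : (0 : ℝ) < N := by linarith
  have hfac : s * p N - s * p N / N = s * p N * (1 - 1 / N) := by ring
  have hsub : (0 : ℝ) < 1 - 1 / N := by
    rw [sub_pos, div_lt_one hN0]
    linarith
  have hsum : (N : ℝ) + n * (((1 - ε) * (s * p N)) ^ k)⁻¹ =
      N * (1 + n / (((1 - ε) * s) ^ k * ((N : ℝ) * (p N : ℝ) ^ k))) := by
    rw [← mul_assoc (1 - ε), mul_pow ((1 - ε) * s)]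
    field_simp
  rw [hfac, hsum, mul_pow (1 - ε), mul_pow (s * (p N : ℝ)), mul_pow (N : ℝ)]
  field_simp

/-- The lower tail probability of `hom_H` is at least `exp (-(1 + η) * (N choose 2) * I_p(s p))`. -/
theorem eventually_exp_le_prob [DecidableEq V] {s η : ℝ} (hm : 0 < H.edgeFinset.card)
    (hs0 : 0 < s) (hs1 : s < 1)
    (hp : (fun N : ℕ => (N : ℝ) ^ (-1 / (2 * (maxEdgeAdj H : ℝ) - 1))) =o[atTop]
      fun N : ℕ => (p N : ℝ))
    (hp2 : ∀ᶠ N : ℕ in atTop, (p N : ℝ) ≤ 1 / 2) (hη : 0 < η) :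
    ∀ᶠ N : ℕ in atTop,
      Real.exp (-((1 + η) * ((N.choose 2 : ℝ) * relEntropy (p N) (s * p N)))) ≤
        (SimpleGraph.binomialRandom (Fin N) (p N)).real
          {G | homGraph H G ≤
            (s * p N - s * p N / N) ^ H.edgeFinset.card * (N : ℝ) ^ Fintype.card V} := by
  classical
  have hc := entropyRate_pos hs0 hs1
  have hκ : 0 ≤ Real.log (4 / s) := Real.log_nonneg (by rw [le_div_iff₀ hs0]; linarith)
  set κ := 2 * Real.log (4 / s) / entropyRate s with hκdef
  have hκ0 : 0 ≤ κ := by positivity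
  obtain ⟨ε, hε0, hε, hεη⟩ : ∃ ε : ℝ, 0 < ε ∧ ε ≤ 1 / 2 ∧ ε * κ ≤ η / 2 := by
    refine ⟨min (1 / 2) (η / 2 / (κ + 1)), by positivity, min_le_left _ _, ?_⟩
    calc _ ≤ η / 2 / (κ + 1) * (κ + 1) :=
          mul_le_mul (min_le_right _ _) (by linarith) hκ0 (by positivity)
      _ = η / 2 := by field_simp
  have h1ε : 0 < 1 - ε := by linarith
  have hD := one_le_maxEdgeAdj H hm
  have hp0 := eventually_pos_of_isLittleO hp
  have hNp : Tendsto (fun N : ℕ => (N : ℝ) * (p N : ℝ)) atTop atTop := by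
    simpa using tendsto_nat_mul_pow_atTop hD hp (k := 1) (by omega)
  have hCp := tendsto_choose_two_mul_atTop hNp
  have hmarkov := eventually_markov_ratio_le H hm hs0 hε0 hε hp0
    (tendsto_nat_mul_pow_atTop hD hp (by omega))
  have hexp1 : ∀ᶠ N : ℕ in atTop,
      Real.exp (-((N.choose 2 : ℝ) * ((1 - ε) * (s * p N)) * ε ^ 2 / 4)) ≤ ε / 4 := by
    have h := Real.tendsto_exp_neg_atTop_nhds_zero.comp
      (hCp.const_mul_atTop (show 0 < (1 - ε) * s * ε ^ 2 / 4 by positivity))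
    filter_upwards [h.eventually_le_const (show 0 < ε / 4 by positivity)] with N hN
    refine le_trans (le_of_eq ?_) hN
    simp only [Function.comp_apply]
    ring_nf
  have hexp2 : ∀ᶠ N : ℕ in atTop,
      Real.exp (-(η / 2 * entropyRate s * ((N.choose 2 : ℝ) * p N))) ≤ ε / 4 :=
    (Real.tendsto_exp_neg_atTop_nhds_zero.comp
      (hCp.const_mul_atTop (show 0 < η / 2 * entropyRate s by positivity))).eventually_le_const
        (show 0 < ε / 4 by positivity)
  filter_upwards [hmarkov, hexp1, hexp2, hp0, hp2, eventually_ge_atTop 2]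
    with N hmarkov hexp1 hexp2 hp0 hp2 hN
  have hN' : (2 : ℝ) ≤ N := by exact_mod_cast hN
  set q := (1 - ε) * (s * p N)
  have hsp : 0 < s * p N := mul_pos hs0 hp0
  have hspp : s * p N < p N := by nlinarith
  have hq0 : 0 < q := by positivity
  have hqsp : q ≤ s * p N := by nlinarith
  set T := (s * p N - s * p N / N) ^ H.edgeFinset.card * (N : ℝ) ^ Fintype.card V
  have hT : 0 < T := by
    have : 0 < s * p N - s * p N / N := sub_pos.2 (div_lt_self hsp (by linarith))
    positivity
  set J := (N.choose 2 : ℝ) * relEntropy (p N) (s * p N) with hJ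
  have hJge : (N.choose 2 : ℝ) * p N * entropyRate s ≤ J := by
    rw [hJ, mul_assoc]
    exact mul_le_mul_of_nonneg_left
      (mul_entropyRate_le_relEntropy hp0 (by linarith) hs1) (by positivity)
  have hJ0 : 0 ≤ J := le_trans (by positivity) hJge
  have htilt := tilted_lower_bound (N := N) (p := p N) hq0 (by linarith) (by linarith) hε0.le
    (by linarith) {G | homGraph H G ≤ T}
  -- Markov leaves probability at least `ε / 2` under `G(N,q)`; few edges cost at most `ε / 4`, so
  -- `ε / 4` remains.
  have hQ := (sub_le_sub_left hmarkov 1).trans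
    (one_sub_div_le_sum_graphWeight H (N := N) hq0 (by linarith) hT)
  refine le_trans ?_ htilt
  -- Half of `η` absorbs the prefactor `ε / 4`, as `J → ∞`; the other half pays for replacing `s *
  -- p` by `q`.
  calc Real.exp (-((1 + η) * J))
      = Real.exp (-(η / 2 * J)) * Real.exp (-((1 + η / 2) * J)) := by
        rw [← Real.exp_add]
        ring_nf
    _ ≤ ε / 4 * Real.exp (-((1 + η / 2) * J)) := by
        refine mul_le_mul_of_nonneg_right (le_trans (Real.exp_le_exp.2 ?_) hexp2)
          (Real.exp_pos _).le
        nlinarith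
    _ ≤ _ := by
        refine mul_le_mul (by linarith) (Real.exp_le_exp.2 (neg_le_neg ?_)) (Real.exp_pos _).le
          (by linarith)
        calc _ ≤ (N.choose 2 : ℝ) * ((1 + ε * κ) * relEntropy (p N) (s * p N)) :=
              mul_le_mul_of_nonneg_left (tilted_exponent_le hp0 hp2 hs0 hs1 hε0 hε) (by positivity)
          _ = (1 + ε * κ) * J := by rw [hJ]; ring
          _ ≤ (1 + η / 2) * J := mul_le_mul_of_nonneg_right (by linarith) hJ0

/-- Lower bounds `exp (-(1 + η) J N)` for all `η > 0` combine into one with `1 + o(1)`. -/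
lemma exists_tendsto_zero_of_forall_exp_le {J P : ℕ → ℝ} (hJ : ∀ᶠ N in atTop, 0 < J N)
    (h : ∀ η > 0, ∀ᶠ N in atTop, Real.exp (-((1 + η) * J N)) ≤ P N) :
    ∃ δ : ℕ → ℝ, Tendsto δ atTop (𝓝 0) ∧
      ∀ᶠ N in atTop, Real.exp (-((1 + δ N) * J N)) ≤ P N := by
  -- The least nonnegative `δ N` for which the bound holds at `N`, provided `J N` and `P N` are
  -- positive.
  refine ⟨fun N => max 0 (-Real.log (P N) / J N - 1), ?_, ?_⟩
  · rw [Metric.tendsto_nhds]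
    intro η hη
    filter_upwards [hJ, h (η / 2) (by positivity)] with N hJN hN
    rw [Real.dist_eq, sub_zero, abs_of_nonneg (le_max_left _ _)]
    refine (max_le (by positivity) ?_ : _ ≤ η / 2).trans_lt (by linarith)
    rw [sub_le_iff_le_add, div_le_iff₀ hJN]
    have := Real.log_le_log (Real.exp_pos _) hN
    rw [Real.log_exp] at this
    linarith
  · filter_upwards [hJ, h 1 one_pos] with N hJN hN
    have hP : 0 < P N := (Real.exp_pos _).trans_le hN
    rw [← Real.le_log_iff_exp_le hP]
    have : -Real.log (P N) / J N ≤ 1 + max 0 (-Real.log (P N) / J N - 1) := by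
      have := le_max_right 0 (-Real.log (P N) / J N - 1)
      linarith
    rw [div_le_iff₀ hJN] at this
    linarith

end Asymptotics

end LowerTail

end

theorem theorem1p9 {V : Type*} [Fintype V] [DecidableEq V]
    (H : SimpleGraph V) [DecidableRel H.Adj] (hH : LowerTail.IsSeminorming H)
    (n m : ℕ) (hn : Fintype.card V = n) (hm : H.edgeFinset.card = m) :
    (∀ (N : ℕ) (p : I) (q : ℝ), 1 ≤ N → 0 < q → q < (p : ℝ) → (p : ℝ) < 1 →
      (SimpleGraph.binomialRandom (Fin N) p).real
          {G | LowerTail.homGraph H G ≤ (q - q / N) ^ m * (N : ℝ) ^ n}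
        ≤ Real.exp (-LowerTail.psi H N p (((q - q / N) / p) ^ m)) ∧
      Real.exp (-LowerTail.psi H N p (((q - q / N) / p) ^ m))
        ≤ Real.exp (-((N.choose 2 : ℝ) * LowerTail.relEntropy p q))) ∧
    (∀ (s : ℝ) (p : ℕ → I), 0 < s → s < 1 →
      (fun N : ℕ => (N : ℝ) ^ (-1 / (2 * (LowerTail.maxEdgeAdj H : ℝ) - 1)))
        =o[atTop] (fun N : ℕ => (p N : ℝ)) →
      (∀ᶠ N : ℕ in atTop, (p N : ℝ) ≤ 1 / 2) →
      ∃ δ : ℕ → ℝ, Tendsto δ atTop (𝓝 0) ∧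
        ∀ᶠ N : ℕ in atTop,
          Real.exp (-((1 + δ N) * (N.choose 2 : ℝ) * LowerTail.relEntropy (p N) (s * p N)))
            ≤ (SimpleGraph.binomialRandom (Fin N) (p N)).real
              {G | LowerTail.homGraph H G ≤
                (s * p N - s * p N / N) ^ m * (N : ℝ) ^ n}) := by
  subst hn hm
  refine ⟨fun N p q hN hq hqp hp1 => ?_, fun s p hs0 hs1 hp hp2 => ?_⟩
  · have : NeZero N := ⟨by omega⟩
    have hp0 : 0 < (p : ℝ) := hq.trans hqp
    refine ⟨?_, Real.exp_le_exp.2 (neg_le_neg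
      (hH.choose_two_mul_relEntropy_le_psi hq hqp hp1))⟩
    have hT : ((q - q / N) / p) ^ H.edgeFinset.card * (N : ℝ) ^ Fintype.card V *
        (p : ℝ) ^ H.edgeFinset.card =
          (q - q / N) ^ H.edgeFinset.card * (N : ℝ) ^ Fintype.card V := by
      rw [div_pow]
      field_simp
    have h := hH.prob_le_exp_neg_psi (N := N) hp0 hp1 (((q - q / N) / p) ^ H.edgeFinset.card)
    rwa [hT] at h
  · have hJ : ∀ᶠ N : ℕ in atTop,
        0 < (N.choose 2 : ℝ) * LowerTail.relEntropy (p N) (s * p N) := by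
      filter_upwards [LowerTail.eventually_pos_of_isLittleO hp, hp2, eventually_ge_atTop 2]
        with N hp0 hp2 hN
      have h := (mul_pos hp0 (LowerTail.entropyRate_pos hs0 hs1)).trans_le
        (LowerTail.mul_entropyRate_le_relEntropy hp0 (by linarith) hs1)
      exact mul_pos (by exact_mod_cast Nat.choose_pos hN) h
    obtain ⟨δ, hδ, h⟩ := LowerTail.exists_tendsto_zero_of_forall_exp_le hJ fun η hη =>
      LowerTail.eventually_exp_le_prob H hH.card_pos hs0 hs1 hp hp2 hη
    exact ⟨δ, hδ, h.mono fun N hN => by rwa [mul_assoc]⟩
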